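/- Let $n\ge 2$ be an integer, let $\alpha=2m$ with $m$ an integer, $1\le m\le n/2$, let $r>0$, and for $\rho>0$ put $\Omega_\rho=\{x\in\mathbb R^n:|x|>\rho\}$. Let $C_{n,\alpha}>0$ be a constant and define, for $x,y\in\Omega_r$ with $x\ne y$, $$G_\alpha(x,y)=C_{n,\alpha}\left(\frac1{|x-y|^{n-\alpha}}-\frac1{\left|\frac{rx}{|x|}-\frac{|x|y}{r}\right|^{n-\alpha}}\right)\quad\text{if }\alpha<n,$$ $$G_\alpha(x,y)=C_{n,\alpha}\left(\ln\frac1{|x-y|}-\ln\frac1{\left|\frac{rx}{|x|}-\frac{|x|y}{r}\right|}\right)\quad\text{if }\alpha=n,$$ and $G_\alpha(x,y)=0$ if $x\notin\Omega_r$ or $y\notin\Omega_r$. Let $f:\Omega_r\times[0,\infty)\to[0,\infty)$ satisfy the following conditions. * (Subcritical growth) If $\alpha<n$: either for all $(x,u)\in\Omega_r\times(0,\infty)$ the function $\mu\mapsto\mu^{\frac{n+\alpha}{n-\alpha}}f(\mu^{\frac2{n-\alpha}}x,\mu^{-1}u)$ is strictly increasing on $\{\mu\ge1\}$, or for all such $(x,u)$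 it is strictly increasing on $\{0<\mu\le1:\mu^{\frac2{n-\alpha}}x\in\Omega_r\}$. If $\alpha=n$: the same holds for $\mu\mapsto\mu^nf(\mu x,u)$ on $\{\mu\ge1\}$, respectively on $\{0<\mu\le1:\mu x\in\Omega_r\}$. * $(\mathbf f_1)$ If $x\in\Omega_r$ and $0\le u\le v$, then $f(x,u)\le f(x,v)$. * $(\mathbf f_2)$ There is a real $\theta<\frac{\alpha}{n}$ such that $g(x,u)=(|x|-r)^\theta f(x,u)$ is locally Lipschitz in $u$: for every $u_0\ge0$ and every bounded $\omega\subseteq\Omega_r$ there are a relatively open neighbourhood $U\subseteq[0,\infty)$ of $u_0$ and a constant $K$ with $|g(x,u)-g(x,v)|\le K|u-v|$ for all $x\in\omega$ and $u,v\in U$. * $(\mathbf f_3)$ There are a cone $\mathcal C\subseteq\mathbb R^n$ with vertex at $0$ (a set invariant under multiplication by positive reals) with nonempty interior, constants $\overline C>0$, $\sigma>1$, and exponents $\tau,p$ with $-\alpha<\tau<\infty$ and $0<p<\frac{n+\alpha+2\tau}{n-\alpha}$ if $\alpha<n$, or $-\alpha\le\tau<\infty$ and $0<p<\infty$ if $\alpha=n$,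 such that $f(x,u)\ge\overline C|x|^\tau u^p$ for all $x\in\mathcal C\cap\Omega_{2\sigma r}$ and $u\ge0$. Let $u\in C(\overline{\Omega_r})$ be nonnegative and such that for every $x\in\Omega_r$ the function $y\mapsto G_\alpha(x,y)f(y,u(y))$ is integrable on $\Omega_r$ and $$u(x)=\int_{\Omega_r}G_\alpha(x,y)f(y,u(y))\,dy .$$ Then $u\equiv0$ in $\overline{\Omega_r}$. -/

import Mathlib

open MeasureTheory

noncomputable section

/-- The exterior domain `Ω_r = {x ∈ ℝⁿ : |x| > r}`. -/
def exteriorDomain (n : ℕ) (r : ℝ) : Set (EuclideanSpace ℝ (Fin n)) :=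
  {x | r < ‖x‖}

/-- The kernel `G_α` of the exterior domain `Ω_r`, with multiplicative constant `c`: the difference
of the Riesz kernel (of the logarithmic kernel if `α = n`) and its reflection in the sphere of
radius `r`, extended by `0` when `x` or `y` lies outside `Ω_r`. -/
def exteriorGreen (n : ℕ) (α r c : ℝ) (x y : EuclideanSpace ℝ (Fin n)) : ℝ :=
  if r < ‖x‖ ∧ r < ‖y‖ then
    if α = n then
      c * (Real.log (1 / ‖x - y‖) - Real.log (1 / ‖(r / ‖x‖) • x - (‖x‖ / r) • y‖))
    else
      c * (1 / ‖x - y‖ ^ ((n : ℝ) - α)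
        - 1 / ‖(r / ‖x‖) • x - (‖x‖ / r) • y‖ ^ ((n : ℝ) - α))
  else 0

/-- Subcritical growth in the non-critical order case `α < n`: the expression
`μ ^ ((n+α)/(n-α)) f (μ ^ (2/(n-α)) x, μ⁻¹ u)` is strictly increasing in `μ ≥ 1`, or in `μ ≤ 1`
(as long as `μ ^ (2/(n-α)) x` remains in the domain of `f`), for all `x ∈ Ω_r` and `u > 0`. -/
def SubcriticalNoncritical (n : ℕ) (α r : ℝ) (f : EuclideanSpace ℝ (Fin n) → ℝ → ℝ) : Prop :=
  (∀ x ∈ exteriorDomain n r, ∀ u : ℝ, 0 < u →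
    StrictMonoOn
      (fun μ : ℝ => μ ^ ((n + α) / (n - α)) * f (μ ^ (2 / (n - α)) • x) (μ⁻¹ * u))
      {μ | 1 ≤ μ}) ∨
  (∀ x ∈ exteriorDomain n r, ∀ u : ℝ, 0 < u →
    StrictMonoOn
      (fun μ : ℝ => μ ^ ((n + α) / (n - α)) * f (μ ^ (2 / (n - α)) • x) (μ⁻¹ * u))
      {μ | 0 < μ ∧ μ ≤ 1 ∧ μ ^ (2 / (n - α)) • x ∈ exteriorDomain n r})

/-- Subcritical growth in the critical order case `α = n`: the expression `μⁿ f (μ x, u)` is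
strictly increasing in `μ ≥ 1`, or in `μ ≤ 1` (as long as `μ x` remains in the domain of `f`),
for all `x ∈ Ω_r` and `u > 0`. -/
def SubcriticalCritical (n : ℕ) (r : ℝ) (f : EuclideanSpace ℝ (Fin n) → ℝ → ℝ) : Prop :=
  (∀ x ∈ exteriorDomain n r, ∀ u : ℝ, 0 < u →
    StrictMonoOn (fun μ : ℝ => μ ^ n * f (μ • x) u) {μ | 1 ≤ μ}) ∨
  (∀ x ∈ exteriorDomain n r, ∀ u : ℝ, 0 < u →
    StrictMonoOn (fun μ : ℝ => μ ^ n * f (μ • x) u)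
      {μ | 0 < μ ∧ μ ≤ 1 ∧ μ • x ∈ exteriorDomain n r})

/-- Subcritical growth, for orders `0 < α ≤ n`. -/
def SubcriticalGrowth (n : ℕ) (α r : ℝ) (f : EuclideanSpace ℝ (Fin n) → ℝ → ℝ) : Prop :=
  (α < n → SubcriticalNoncritical n α r f) ∧ (α = n → SubcriticalCritical n r f)

/-- `g` is locally Lipschitz on `u` in `Ω_r × [0, ∞)`: for every `u₀ ≥ 0` and every bounded
`ω ⊆ Ω_r` there is a relatively open neighbourhood `V ∩ [0, ∞)` of `u₀` on which the functions
`g (x, ·)`, `x ∈ ω`, are Lipschitz with a common constant. -/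
def LocallyLipschitzInU (n : ℕ) (r : ℝ) (g : EuclideanSpace ℝ (Fin n) → ℝ → ℝ) : Prop :=
  ∀ u₀ : ℝ, 0 ≤ u₀ → ∀ ω ⊆ exteriorDomain n r, Bornology.IsBounded ω →
    ∃ V : Set ℝ, IsOpen V ∧ u₀ ∈ V ∧
      ∃ K : NNReal, ∀ x ∈ ω, LipschitzOnWith K (g x) (V ∩ Set.Ici 0)

/-- Assumption (f₁): `f` is non-decreasing in `u` on `Ω_r × [0, ∞)`. -/
def AssumptionF1 (n : ℕ) (r : ℝ) (f : EuclideanSpace ℝ (Fin n) → ℝ → ℝ) : Prop :=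
  ∀ x ∈ exteriorDomain n r, ∀ u v : ℝ, 0 ≤ u → u ≤ v → f x u ≤ f x v

/-- Assumption (f₂): for some `θ < α / n`, `(|x| - r) ^ θ f (x, u)` is locally Lipschitz on `u`. -/
def AssumptionF2 (n : ℕ) (α r : ℝ) (f : EuclideanSpace ℝ (Fin n) → ℝ → ℝ) : Prop :=
  ∃ θ : ℝ, θ < α / n ∧ LocallyLipschitzInU n r (fun x u => (‖x‖ - r) ^ θ * f x u)

/-- A (solid, not necessarily convex) cone with vertex at `0`: a set with nonempty interior that is
invariant under multiplication by positive reals. -/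
def IsSolidCone (n : ℕ) (C : Set (EuclideanSpace ℝ (Fin n))) : Prop :=
  (∀ x ∈ C, ∀ t : ℝ, 0 < t → t • x ∈ C) ∧ (interior C).Nonempty

/-- Assumption (f₃): the lower bound `f (x, u) ≥ C' |x| ^ τ u ^ p` on `(C ∩ Ω_{2σr}) × [0, ∞)` for
some cone `C` with vertex `0`, some `C' > 0`, `σ > 1` and admissible exponents `τ` and `p`. -/
def AssumptionF3 (n : ℕ) (α r : ℝ) (f : EuclideanSpace ℝ (Fin n) → ℝ → ℝ) : Prop :=
  ∃ (C : Set (EuclideanSpace ℝ (Fin n))) (C' σ τ p : ℝ),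
    IsSolidCone n C ∧ 0 < C' ∧ 1 < σ ∧
    (α < n → -α < τ ∧ 0 < p ∧ p < (n + α + 2 * τ) / (n - α)) ∧
    (α = n → -α ≤ τ ∧ 0 < p) ∧
    ∀ x ∈ C ∩ exteriorDomain n (2 * σ * r), ∀ u : ℝ, 0 ≤ u → C' * ‖x‖ ^ τ * u ^ p ≤ f x u

/-- `u` solves `u(x) = ∫_{Ω_r} G_α(x, y) f(y, u(y)) dy` for `x ∈ Ω_r`; the convergence of the
integral is part of the notion of solution. -/
def IsIntegralSolution (n : ℕ) (α r c : ℝ) (f : EuclideanSpace ℝ (Fin n) → ℝ → ℝ)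
    (u : EuclideanSpace ℝ (Fin n) → ℝ) : Prop :=
  ∀ x ∈ exteriorDomain n r,
    IntegrableOn (fun y => exteriorGreen n α r c x y * f y (u y)) (exteriorDomain n r) volume ∧
    u x = ∫ y in exteriorDomain n r, exteriorGreen n α r c x y * f y (u y)

end

/-!
The proof is by the method of scaling spheres. If `u` does not vanish identically, it is positive
in the exterior domain. Let `u_l(x) = (l / |x|) ^ (n - α) u(l² x / |x|²)` be the Kelvin transform of
`u` in the sphere of radius `l > r`. Splitting the integral equation at this sphere and folding its
outer part back by the inversion (`foldedIntegrand_integral_le`) bounds `u_l - u` in the annulus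
`{r < |x| < l}` from below by an integral over the same annulus. Its kernel is explicit
(`kelvinKernel_reflected`): the Green kernel is the difference of a decreasing profile at two squared
distances, and all signs follow from factorizations of differences of such squared distances.
Subcritical growth (`SubcriticalGrowth.lt_kelvin`) and the monotonicity of `f` then give
`u_l - u ≥ -∫ P(x, y) (f(y, u) - f(y, u_l))⁺ dy` with a positive kernel `P`.

By the weighted Lipschitz condition this makes `sup (u - u_l)⁺` at most half of itself as soon as
the set `{u_l < u}` is thin enough (`IsPositiveSolution.exists_contraction`); the condition `θ < α / n`
is what makes the product of the singularities `(|y| - r) ^ (-θ)` and `|x - y| ^ (α - n)` uniformly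
integrable (`exists_forall_singular_integral_le`). The supremum norm suffices, since `u` is bounded on
annuli. If `u ≤ u_l` then `u < u_l`, so the sets `{u_l' < u}` shrink to a null set as `l'` decreases
to `l`, and the sphere can always be moved out. Hence `u ≤ u_l` for all `l`
(`IsPositiveSolution.le_kelvin`).

Spheres through the geometric mean of two radii turn this into `u ≥ κ |x| ^ (-(n - α) / 2)` far out.
Inserting a bound `u ≥ κ |x| ^ μ` into the integral over dilated balls in the cone improves the
exponent to `α + τ + p μ`. The conditions on `p` and `τ` make the improvement uniform while
`μ` is negative, and `μ = 0` contradicts the convergence of the integral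
(`IsPositiveSolution.not_assumptionF3`).
-/

open MeasureTheory Filter Topology

/-! ### The kernel and the inversion -/

section Kernel

/-- The radial profile of the Riesz kernel `|x - y| ^ (-a)` (of the logarithmic kernel
`-log |x - y|` if `a = 0`), as a function of the *squared* distance. -/
noncomputable def rieszProfile (a q : ℝ) : ℝ :=
  if a = 0 then -(1 / 2) * Real.log q else q ^ (-(a / 2))

lemma rieszProfile_lt {a : ℝ} (ha : 0 ≤ a) {p q : ℝ} (hp : 0 < p) (hpq : p < q) :
    rieszProfile a q < rieszProfile a p := by
  unfold rieszProfile
  split_ifs with h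
  · have := Real.log_lt_log hp hpq
    linarith
  · have : 0 < a := lt_of_le_of_ne ha (Ne.symm h)
    exact Real.rpow_lt_rpow_of_neg hp hpq (by linarith)

lemma rieszProfile_le {a : ℝ} (ha : 0 ≤ a) {p q : ℝ} (hp : 0 < p) (hpq : p ≤ q) :
    rieszProfile a q ≤ rieszProfile a p := by
  rcases hpq.eq_or_lt with rfl | h
  · exact le_rfl
  · exact (rieszProfile_lt ha hp h).le

lemma rieszProfile_sq (a : ℝ) {d : ℝ} (hd : 0 < d) :
    rieszProfile a (d ^ 2) = if a = 0 then Real.log (1 / d) else 1 / d ^ a := by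
  unfold rieszProfile
  split_ifs with h
  · rw [Real.log_pow, one_div d, Real.log_inv]; push_cast; ring
  · rw [← Real.rpow_natCast, ← Real.rpow_mul hd.le, one_div, ← Real.rpow_neg hd.le]
    congr 1; push_cast; ring

/-- The Riesz profile is homogeneous; the logarithmic one is so up to an additive constant, which
disappears from differences. -/
lemma rieszProfile_mul_sub (a : ℝ) {l q q' : ℝ} (hl : 0 < l) (hq : 0 < q) (hq' : 0 < q') :
    rieszProfile a (l ^ 2 * q) - rieszProfile a (l ^ 2 * q')
      = (1 / l) ^ a * (rieszProfile a q - rieszProfile a q') := by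
  unfold rieszProfile
  split_ifs with h
  · rw [Real.log_mul (by positivity) hq.ne', Real.log_mul (by positivity) hq'.ne', h,
      Real.rpow_zero]; ring
  · have : (1 / l) ^ a = (l ^ 2) ^ (-(a / 2)) := by
      rw [one_div, Real.inv_rpow hl.le, ← Real.rpow_neg hl.le, ← Real.rpow_natCast,
        ← Real.rpow_mul hl.le]
      congr 1; push_cast; ring
    rw [Real.mul_rpow (by positivity) hq.le, Real.mul_rpow (by positivity) hq'.le, this]; ring

variable {n : ℕ}

local notation "⟪" x ", " y "⟫" => inner ℝ x y

lemma norm_sub_sq_pos {x y : EuclideanSpace ℝ (Fin n)} (hxy : x ≠ y) :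
    0 < ‖x‖ ^ 2 + ‖y‖ ^ 2 - 2 * ⟪x, y⟫ := by
  have h := norm_sub_sq_real x y
  have : 0 < ‖x - y‖ := norm_pos_iff.2 (sub_ne_zero.2 hxy)
  have : 0 < ‖x - y‖ ^ 2 := by positivity
  linarith

/-- The square of the reflected distance in the Green kernel exceeds the square of the distance by a
product that is positive in the exterior domain. Here `s = |x|`, `t = |y|`, `p = ⟨x, y⟩`. -/
lemma reflected_sub_sq {r : ℝ} (hr : 0 < r) (s t p : ℝ) :
    r ^ 2 - 2 * p + s ^ 2 * t ^ 2 / r ^ 2 =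
      (s ^ 2 + t ^ 2 - 2 * p) + (s ^ 2 - r ^ 2) * (t ^ 2 - r ^ 2) / r ^ 2 := by
  field_simp; ring

lemma reflected_pos {r s t p : ℝ} (hr : 0 < r) (hs : r < s) (ht : r < t)
    (h : 0 < s ^ 2 + t ^ 2 - 2 * p) : 0 < r ^ 2 - 2 * p + s ^ 2 * t ^ 2 / r ^ 2 := by
  rw [reflected_sub_sq hr]
  have h1 : 0 < s ^ 2 - r ^ 2 := by nlinarith
  have h2 : 0 < t ^ 2 - r ^ 2 := by nlinarith
  positivity

lemma exteriorGreen_eq {α r c : ℝ} (hr : 0 < r) {x y : EuclideanSpace ℝ (Fin n)}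
    (hx : r < ‖x‖) (hy : r < ‖y‖) (hxy : x ≠ y) :
    exteriorGreen n α r c x y =
      c * (rieszProfile (n - α) (‖x‖ ^ 2 + ‖y‖ ^ 2 - 2 * ⟪x, y⟫)
        - rieszProfile (n - α) (r ^ 2 - 2 * ⟪x, y⟫ + ‖x‖ ^ 2 * ‖y‖ ^ 2 / r ^ 2)) := by
  have hx0 : 0 < ‖x‖ := hr.trans hx
  have hd : 0 < ‖x - y‖ := norm_pos_iff.2 (sub_ne_zero.2 hxy)
  have h1 : ‖x‖ ^ 2 + ‖y‖ ^ 2 - 2 * ⟪x, y⟫ = ‖x - y‖ ^ 2 := by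
    rw [norm_sub_sq_real]; ring
  have h2 : r ^ 2 - 2 * ⟪x, y⟫ + ‖x‖ ^ 2 * ‖y‖ ^ 2 / r ^ 2
      = ‖(r / ‖x‖) • x - (‖x‖ / r) • y‖ ^ 2 := by
    rw [norm_sub_sq_real, norm_smul, norm_smul, real_inner_smul_left, real_inner_smul_right,
      Real.norm_of_nonneg (by positivity), Real.norm_of_nonneg (by positivity)]
    field_simp
  have he : 0 < ‖(r / ‖x‖) • x - (‖x‖ / r) • y‖ := by
    have h := reflected_pos hr hx hy (norm_sub_sq_pos hxy)
    rw [h2] at h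
    exact lt_of_le_of_ne (norm_nonneg _) fun h0 => by rw [← h0] at h; simp at h
  rw [h1, h2, rieszProfile_sq _ hd, rieszProfile_sq _ he, exteriorGreen, if_pos ⟨hx, hy⟩]
  by_cases h : α = n
  · simp [h]
  · have h' : (n : ℝ) - α ≠ 0 := fun h0 => h (by linarith)
    simp [h, h']

lemma exteriorGreen_pos {α r c : ℝ} (hα : α ≤ n) (hr : 0 < r) (hc : 0 < c)
    {x y : EuclideanSpace ℝ (Fin n)} (hx : r < ‖x‖) (hy : r < ‖y‖) (hxy : x ≠ y) :
    0 < exteriorGreen n α r c x y := by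
  rw [exteriorGreen_eq hr hx hy hxy]
  refine mul_pos hc (sub_pos.2 (rieszProfile_lt (by linarith) (norm_sub_sq_pos hxy) ?_))
  rw [reflected_sub_sq hr]
  have h1 : 0 < ‖x‖ ^ 2 - r ^ 2 := by nlinarith
  have h2 : 0 < ‖y‖ ^ 2 - r ^ 2 := by nlinarith
  have : 0 < (‖x‖ ^ 2 - r ^ 2) * (‖y‖ ^ 2 - r ^ 2) / r ^ 2 := by positivity
  linarith

/-- The inversion in the sphere of radius `l` centred at `0`. -/
noncomputable def sphereInv (l : ℝ) (x : EuclideanSpace ℝ (Fin n)) : EuclideanSpace ℝ (Fin n) :=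
  (l / ‖x‖) ^ 2 • x

lemma norm_sphereInv (l : ℝ) {x : EuclideanSpace ℝ (Fin n)} (hx : 0 < ‖x‖) :
    ‖sphereInv l x‖ = l ^ 2 / ‖x‖ := by
  rw [sphereInv, norm_smul, Real.norm_of_nonneg (by positivity)]
  field_simp

lemma sphereInv_sphereInv {l : ℝ} (hl : 0 < l) {x : EuclideanSpace ℝ (Fin n)} (hx : 0 < ‖x‖) :
    sphereInv l (sphereInv l x) = x := by
  have h := norm_sphereInv l hx
  rw [sphereInv, h, sphereInv, smul_smul]
  have : (l / (l ^ 2 / ‖x‖)) ^ 2 * (l / ‖x‖) ^ 2 = 1 := by field_simp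
  rw [this, one_smul]

lemma lt_norm_sphereInv {l : ℝ} {x : EuclideanSpace ℝ (Fin n)} (hx : 0 < ‖x‖) (hxl : ‖x‖ < l) :
    l < ‖sphereInv l x‖ := by
  rw [norm_sphereInv l hx, lt_div_iff₀ hx]; nlinarith

/-- The kernel of `u_l - u`, where `u_l` is the Kelvin transform of `u` in the sphere of
radius `l`. -/
noncomputable def kelvinKernel (n : ℕ) (α r c l : ℝ) (x y : EuclideanSpace ℝ (Fin n)) : ℝ :=
  (l / ‖x‖) ^ ((n : ℝ) - α) * exteriorGreen n α r c (sphereInv l x) y - exteriorGreen n α r c x y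

/-- Reflecting one variable of the Green kernel, with the conformal factor, produces the same profile
at two other squared distances; the factor is absorbed by `rieszProfile_mul_sub`. -/
lemma kelvin_green_eq {α r c l : ℝ} (hr : 0 < r) {x y : EuclideanSpace ℝ (Fin n)}
    (hx : r < ‖x‖) (hxl : ‖x‖ < l) (hy : r < ‖y‖) (hixy : sphereInv l x ≠ y) :
    0 < ‖x‖ ^ 2 * ‖y‖ ^ 2 / l ^ 2 - 2 * ⟪x, y⟫ + l ^ 2 ∧
    0 < r ^ 2 * ‖x‖ ^ 2 / l ^ 2 - 2 * ⟪x, y⟫ + ‖y‖ ^ 2 * l ^ 2 / r ^ 2 ∧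
    (l / ‖x‖) ^ ((n : ℝ) - α) * exteriorGreen n α r c (sphereInv l x) y =
      c * (rieszProfile (n - α) (‖x‖ ^ 2 * ‖y‖ ^ 2 / l ^ 2 - 2 * ⟪x, y⟫ + l ^ 2)
        - rieszProfile (n - α)
          (r ^ 2 * ‖x‖ ^ 2 / l ^ 2 - 2 * ⟪x, y⟫ + ‖y‖ ^ 2 * l ^ 2 / r ^ 2)) := by
  have hx0 : 0 < ‖x‖ := hr.trans hx
  have hl0 : 0 < l := hx0.trans hxl
  have hix := lt_norm_sphereInv hx0 hxl
  have hN := norm_sphereInv l hx0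
  have hI : ⟪sphereInv l x, y⟫ = (l / ‖x‖) ^ 2 * ⟪x, y⟫ := by
    rw [sphereInv, real_inner_smul_left]
  have hD := norm_sub_sq_pos hixy
  have hE := reflected_pos hr (by linarith) hy hD
  have e1 : ‖x‖ ^ 2 * ‖y‖ ^ 2 / l ^ 2 - 2 * ⟪x, y⟫ + l ^ 2
      = (‖x‖ / l) ^ 2 * (‖sphereInv l x‖ ^ 2 + ‖y‖ ^ 2 - 2 * ⟪sphereInv l x, y⟫) := by
    rw [hN, hI]; field_simp; ring
  have e2 : r ^ 2 * ‖x‖ ^ 2 / l ^ 2 - 2 * ⟪x, y⟫ + ‖y‖ ^ 2 * l ^ 2 / r ^ 2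
      = (‖x‖ / l) ^ 2 *
        (r ^ 2 - 2 * ⟪sphereInv l x, y⟫ + ‖sphereInv l x‖ ^ 2 * ‖y‖ ^ 2 / r ^ 2) := by
    rw [hN, hI]; field_simp
  refine ⟨by rw [e1]; positivity, by rw [e2]; positivity, ?_⟩
  rw [exteriorGreen_eq hr (by linarith) hy hixy, e1, e2,
    rieszProfile_mul_sub _ (by positivity) hD hE, one_div_div]
  ring

/-- Outside the sphere the kernel of `u_l - u` is nonnegative. -/
lemma kelvinKernel_nonneg {α r c l : ℝ} (hα : α ≤ n) (hr : 0 < r) (hc : 0 < c)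
    {x y : EuclideanSpace ℝ (Fin n)} (hx : r < ‖x‖) (hxl : ‖x‖ < l) (hy : l < ‖y‖)
    (hixy : sphereInv l x ≠ y) : 0 ≤ kelvinKernel n α r c l x y := by
  have hxy : x ≠ y := by rintro rfl; linarith
  have hry : r < ‖y‖ := by linarith
  have hx0 : 0 < ‖x‖ := hr.trans hx
  have hl0 : 0 < l := hx0.trans hxl
  obtain ⟨hB, hH, hG⟩ := kelvin_green_eq (α := α) (c := c) hr hx hxl hry hixy
  rw [kelvinKernel, hG, exteriorGreen_eq hr hx hry hxy, ← mul_sub]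
  have hD := norm_sub_sq_pos hxy
  have hE := reflected_pos hr hx hry hD
  have g1 : 0 < l ^ 2 - ‖x‖ ^ 2 := by nlinarith
  have g2 : 0 < ‖y‖ ^ 2 - l ^ 2 := by nlinarith
  have g3 : 0 < ‖y‖ ^ 2 * l ^ 2 - r ^ 4 := by
    have : r ^ 2 < ‖y‖ ^ 2 := by nlinarith
    have : r ^ 2 < l ^ 2 := by nlinarith
    nlinarith [sq_nonneg r]
  have h1 := rieszProfile_le (a := n - α) (by linarith) hB
    (q := ‖x‖ ^ 2 + ‖y‖ ^ 2 - 2 * ⟪x, y⟫) (by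
      have e : ‖x‖ ^ 2 + ‖y‖ ^ 2 - 2 * ⟪x, y⟫ = ‖x‖ ^ 2 * ‖y‖ ^ 2 / l ^ 2 - 2 * ⟪x, y⟫ + l ^ 2
        + (l ^ 2 - ‖x‖ ^ 2) * (‖y‖ ^ 2 - l ^ 2) / l ^ 2 := by field_simp; ring
      rw [e]
      exact le_add_of_nonneg_right (by positivity))
  have h2 := rieszProfile_le (a := n - α) (by linarith) hE
    (q := r ^ 2 * ‖x‖ ^ 2 / l ^ 2 - 2 * ⟪x, y⟫ + ‖y‖ ^ 2 * l ^ 2 / r ^ 2) (by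
      have e : r ^ 2 * ‖x‖ ^ 2 / l ^ 2 - 2 * ⟪x, y⟫ + ‖y‖ ^ 2 * l ^ 2 / r ^ 2
        = r ^ 2 - 2 * ⟪x, y⟫ + ‖x‖ ^ 2 * ‖y‖ ^ 2 / r ^ 2
        + (l ^ 2 - ‖x‖ ^ 2) * (‖y‖ ^ 2 * l ^ 2 - r ^ 4) / (l ^ 2 * r ^ 2) := by
          field_simp; ring
      rw [e]
      exact le_add_of_nonneg_right (by positivity))
  exact mul_nonneg hc.le (by linarith)

/-- The doubly reflected kernel is a combination of four profiles. All four squared distances have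
the common term `-2 ⟨x, y⟩`, so that differences of them factor. -/
lemma kelvinKernel_reflected_eq {α r c l : ℝ} (hr : 0 < r)
    {x y : EuclideanSpace ℝ (Fin n)} (hx : r < ‖x‖) (hxl : ‖x‖ < l) (hy : r < ‖y‖) (hyl : ‖y‖ < l)
    (hxy : x ≠ y) :
    0 < r ^ 2 * ‖x‖ ^ 2 * ‖y‖ ^ 2 / l ^ 4 - 2 * ⟪x, y⟫ + l ^ 4 / r ^ 2 ∧
    (l / ‖y‖) ^ ((n : ℝ) - α) * kelvinKernel n α r c l x (sphereInv l y) =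
        c * (rieszProfile (n - α) (‖x‖ ^ 2 + ‖y‖ ^ 2 - 2 * ⟪x, y⟫)
          - rieszProfile (n - α) (r ^ 2 * ‖x‖ ^ 2 * ‖y‖ ^ 2 / l ^ 4 - 2 * ⟪x, y⟫ + l ^ 4 / r ^ 2)
          - (rieszProfile (n - α) (‖x‖ ^ 2 * ‖y‖ ^ 2 / l ^ 2 - 2 * ⟪x, y⟫ + l ^ 2)
          - rieszProfile (n - α)
            (r ^ 2 * ‖y‖ ^ 2 / l ^ 2 - 2 * ⟪x, y⟫ + ‖x‖ ^ 2 * l ^ 2 / r ^ 2))) := by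
  have hx0 : 0 < ‖x‖ := hr.trans hx
  have hy0 : 0 < ‖y‖ := hr.trans hy
  have hl0 : 0 < l := hx0.trans hxl
  have hiy := lt_norm_sphereInv hy0 hyl
  have hxiy : x ≠ sphereInv l y := by intro h; rw [← h] at hiy; linarith
  have hixiy : sphereInv l x ≠ sphereInv l y := by
    intro h; apply hxy
    rw [← sphereInv_sphereInv hl0 hx0, h, sphereInv_sphereInv hl0 hy0]
  obtain ⟨hD', hF', hG2⟩ := kelvin_green_eq (α := α) (c := c) hr hx hxl
    (y := sphereInv l y) (by linarith) hixiy
  have hB' := norm_sub_sq_pos hxiy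
  have hHy' := reflected_pos hr hx (by linarith) hB'
  have hNy := norm_sphereInv l hy0
  have hI : ⟪x, sphereInv l y⟫ = (l / ‖y‖) ^ 2 * ⟪x, y⟫ := by
    rw [sphereInv, real_inner_smul_right]
  have s1 := rieszProfile_mul_sub (n - α) (l := ‖y‖ / l) (by positivity) hD' hF'
  have s2 := rieszProfile_mul_sub (n - α) (l := ‖y‖ / l) (by positivity) hB' hHy'
  rw [one_div_div] at s1 s2
  have t1 : (‖y‖ / l) ^ 2 * (‖x‖ ^ 2 * ‖sphereInv l y‖ ^ 2 / l ^ 2 - 2 * ⟪x, sphereInv l y⟫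
      + l ^ 2) = ‖x‖ ^ 2 + ‖y‖ ^ 2 - 2 * ⟪x, y⟫ := by
    rw [hNy, hI]; field_simp; ring
  have t2 : (‖y‖ / l) ^ 2 * (r ^ 2 * ‖x‖ ^ 2 / l ^ 2 - 2 * ⟪x, sphereInv l y⟫
      + ‖sphereInv l y‖ ^ 2 * l ^ 2 / r ^ 2)
      = r ^ 2 * ‖x‖ ^ 2 * ‖y‖ ^ 2 / l ^ 4 - 2 * ⟪x, y⟫ + l ^ 4 / r ^ 2 := by
    rw [hNy, hI]; field_simp
  have t3 : (‖y‖ / l) ^ 2 * (‖x‖ ^ 2 + ‖sphereInv l y‖ ^ 2 - 2 * ⟪x, sphereInv l y⟫)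
      = ‖x‖ ^ 2 * ‖y‖ ^ 2 / l ^ 2 - 2 * ⟪x, y⟫ + l ^ 2 := by
    rw [hNy, hI]; field_simp; ring
  have t4 : (‖y‖ / l) ^ 2 * (r ^ 2 - 2 * ⟪x, sphereInv l y⟫
      + ‖x‖ ^ 2 * ‖sphereInv l y‖ ^ 2 / r ^ 2)
      = r ^ 2 * ‖y‖ ^ 2 / l ^ 2 - 2 * ⟪x, y⟫ + ‖x‖ ^ 2 * l ^ 2 / r ^ 2 := by
    rw [hNy, hI]; field_simp
  refine ⟨by rw [← t2]; positivity, ?_⟩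
  rw [t1, t2] at s1
  rw [t3, t4] at s2
  rw [kelvinKernel, hG2, exteriorGreen_eq hr hx (by linarith) hxiy, mul_sub, mul_sub, mul_sub]
  linear_combination (-c) * s1 + c * s2

/-- Inside the sphere, the kernel of `u_l - u` with its second variable reflected, multiplied by the
conformal factor, is positive, exceeds the negative of the unreflected kernel (whose sign is not
definite), and is bounded by the difference of two profiles, of which the second does not depend on
the points. -/
lemma kelvinKernel_reflected {α r c l : ℝ} (hα : α ≤ n) (hr : 0 < r) (hc : 0 < c)
    {x y : EuclideanSpace ℝ (Fin n)} (hx : r < ‖x‖) (hxl : ‖x‖ < l) (hy : r < ‖y‖) (hyl : ‖y‖ < l)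
    (hxy : x ≠ y) :
    0 < (l / ‖y‖) ^ ((n : ℝ) - α) * kelvinKernel n α r c l x (sphereInv l y) ∧
    0 < (l / ‖y‖) ^ ((n : ℝ) - α) * kelvinKernel n α r c l x (sphereInv l y)
      + kelvinKernel n α r c l x y ∧
    (l / ‖y‖) ^ ((n : ℝ) - α) * kelvinKernel n α r c l x (sphereInv l y) ≤
      c * (rieszProfile (n - α) (‖x - y‖ ^ 2) - rieszProfile (n - α) ((r + l ^ 2 / r) ^ 2)) := by
  have hx0 : 0 < ‖x‖ := hr.trans hx
  have hy0 : 0 < ‖y‖ := hr.trans hy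
  have hl0 : 0 < l := hx0.trans hxl
  have ha : 0 ≤ (n : ℝ) - α := by linarith
  have hix := lt_norm_sphereInv hx0 hxl
  have hixy : sphereInv l x ≠ y := by intro h; rw [h] at hix; linarith
  obtain ⟨hB, hHx, hG1⟩ := kelvin_green_eq (α := α) (c := c) hr hx hxl hy hixy
  have hD := norm_sub_sq_pos hxy
  have hE := reflected_pos hr hx hy hD
  obtain ⟨hF, eW⟩ := kelvinKernel_reflected_eq (α := α) (c := c) hr hx hxl hy hyl hxy
  have g1 : 0 < l ^ 2 - ‖x‖ ^ 2 := sub_pos.2 (pow_lt_pow_left₀ hxl hx0.le two_ne_zero)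
  have g2 : 0 < l ^ 2 - ‖y‖ ^ 2 := sub_pos.2 (pow_lt_pow_left₀ hyl hy0.le two_ne_zero)
  have g0 : r ^ 2 < l ^ 2 := pow_lt_pow_left₀ (hx.trans hxl) hr.le two_ne_zero
  have gx : r ^ 2 < ‖x‖ ^ 2 := pow_lt_pow_left₀ hx hr.le two_ne_zero
  have gy : r ^ 2 < ‖y‖ ^ 2 := pow_lt_pow_left₀ hy hr.le two_ne_zero
  have g3 : 0 < ‖x‖ ^ 2 * l ^ 2 - r ^ 4 := by
    have := mul_lt_mul'' gx g0 (by positivity) (by positivity)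
    rw [← pow_add] at this
    exact sub_pos.2 this
  have g4 : 0 < ‖y‖ ^ 2 * l ^ 2 - r ^ 4 := by
    have := mul_lt_mul'' gy g0 (by positivity) (by positivity)
    rw [← pow_add] at this
    exact sub_pos.2 this
  have g6 : 0 < l ^ 4 - r ^ 2 * ‖y‖ ^ 2 := by
    have := mul_lt_mul'' g0 (sub_pos.1 g2) (by positivity) (by positivity)
    rw [← pow_add] at this
    exact sub_pos.2 this
  have hHy : 0 < r ^ 2 * ‖y‖ ^ 2 / l ^ 2 - 2 * ⟪x, y⟫ + ‖x‖ ^ 2 * l ^ 2 / r ^ 2 := by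
    have e : r ^ 2 * ‖y‖ ^ 2 / l ^ 2 - 2 * ⟪x, y⟫ + ‖x‖ ^ 2 * l ^ 2 / r ^ 2
        = r ^ 2 - 2 * ⟪x, y⟫ + ‖x‖ ^ 2 * ‖y‖ ^ 2 / r ^ 2
        + (l ^ 2 - ‖y‖ ^ 2) * (‖x‖ ^ 2 * l ^ 2 - r ^ 4) / (l ^ 2 * r ^ 2) := by
          field_simp; ring
    rw [e]; positivity
  have hDB := rieszProfile_lt ha hD
    (q := ‖x‖ ^ 2 * ‖y‖ ^ 2 / l ^ 2 - 2 * ⟪x, y⟫ + l ^ 2) (by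
      have e : ‖x‖ ^ 2 * ‖y‖ ^ 2 / l ^ 2 - 2 * ⟪x, y⟫ + l ^ 2 = ‖x‖ ^ 2 + ‖y‖ ^ 2 - 2 * ⟪x, y⟫
        + (l ^ 2 - ‖x‖ ^ 2) * (l ^ 2 - ‖y‖ ^ 2) / l ^ 2 := by field_simp; ring
      rw [e]; exact lt_add_of_pos_right _ (by positivity))
  have hHF := rieszProfile_lt ha hHy
    (q := r ^ 2 * ‖x‖ ^ 2 * ‖y‖ ^ 2 / l ^ 4 - 2 * ⟪x, y⟫ + l ^ 4 / r ^ 2) (by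
      have e : r ^ 2 * ‖x‖ ^ 2 * ‖y‖ ^ 2 / l ^ 4 - 2 * ⟪x, y⟫ + l ^ 4 / r ^ 2
        = r ^ 2 * ‖y‖ ^ 2 / l ^ 2 - 2 * ⟪x, y⟫ + ‖x‖ ^ 2 * l ^ 2 / r ^ 2
        + (l ^ 2 - ‖x‖ ^ 2) * (l ^ 6 - r ^ 4 * ‖y‖ ^ 2) / (l ^ 4 * r ^ 2) := by
          field_simp; ring
      have : 0 < l ^ 6 - r ^ 4 * ‖y‖ ^ 2 := by
        have h4 : r ^ 4 < l ^ 4 := pow_lt_pow_left₀ (by linarith) hr.le (by norm_num)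
        have := mul_lt_mul'' h4 (sub_pos.1 g2) (by positivity) (by positivity)
        rw [← pow_add] at this
        exact sub_pos.2 this
      rw [e]; exact lt_add_of_pos_right _ (by positivity))
  have hEH := rieszProfile_lt ha hE
    (q := r ^ 2 * ‖x‖ ^ 2 / l ^ 2 - 2 * ⟪x, y⟫ + ‖y‖ ^ 2 * l ^ 2 / r ^ 2) (by
      have e : r ^ 2 * ‖x‖ ^ 2 / l ^ 2 - 2 * ⟪x, y⟫ + ‖y‖ ^ 2 * l ^ 2 / r ^ 2
        = r ^ 2 - 2 * ⟪x, y⟫ + ‖x‖ ^ 2 * ‖y‖ ^ 2 / r ^ 2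
        + (l ^ 2 - ‖x‖ ^ 2) * (‖y‖ ^ 2 * l ^ 2 - r ^ 4) / (l ^ 2 * r ^ 2) := by
          field_simp; ring
      rw [e]; exact lt_add_of_pos_right _ (by positivity))
  have hBH := rieszProfile_le ha hB
    (q := r ^ 2 * ‖y‖ ^ 2 / l ^ 2 - 2 * ⟪x, y⟫ + ‖x‖ ^ 2 * l ^ 2 / r ^ 2) (by
      have e : r ^ 2 * ‖y‖ ^ 2 / l ^ 2 - 2 * ⟪x, y⟫ + ‖x‖ ^ 2 * l ^ 2 / r ^ 2
        = ‖x‖ ^ 2 * ‖y‖ ^ 2 / l ^ 2 - 2 * ⟪x, y⟫ + l ^ 2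
        + (l ^ 4 - r ^ 2 * ‖y‖ ^ 2) * (‖x‖ ^ 2 - r ^ 2) / (l ^ 2 * r ^ 2) := by
          field_simp; ring
      have : 0 < ‖x‖ ^ 2 - r ^ 2 := by linarith
      rw [e]; exact le_add_of_nonneg_right (by positivity))
  have hFR := rieszProfile_le ha hF (q := (r + l ^ 2 / r) ^ 2) (by
      have h1 : -⟪x, y⟫ ≤ ‖x‖ * ‖y‖ := by
        have := abs_real_inner_le_norm x y
        have := neg_abs_le ⟪x, y⟫
        linarith
      have h2 : ‖x‖ * ‖y‖ ≤ l ^ 2 := by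
        rw [pow_two]; exact mul_le_mul hxl.le hyl.le hy0.le hl0.le
      have h3 : r ^ 2 * ‖x‖ ^ 2 * ‖y‖ ^ 2 / l ^ 4 ≤ r ^ 2 := by
        rw [div_le_iff₀ (by positivity)]
        calc r ^ 2 * ‖x‖ ^ 2 * ‖y‖ ^ 2 = r ^ 2 * (‖x‖ * ‖y‖) ^ 2 := by ring
          _ ≤ r ^ 2 * (l ^ 2) ^ 2 := by gcongr
          _ = r ^ 2 * l ^ 4 := by ring
      have e : (r + l ^ 2 / r) ^ 2 = r ^ 2 + 2 * l ^ 2 + l ^ 4 / r ^ 2 := by field_simp; ring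
      rw [e]; linarith)
  refine ⟨?_, ?_, ?_⟩
  · rw [eW]; exact mul_pos hc (by linarith)
  · rw [eW, kelvinKernel, hG1, exteriorGreen_eq hr hx hy hxy, ← mul_sub, ← mul_add]
    exact mul_pos hc (by linarith)
  · rw [eW]
    have e : ‖x - y‖ ^ 2 = ‖x‖ ^ 2 + ‖y‖ ^ 2 - 2 * ⟪x, y⟫ := by rw [norm_sub_sq_real]; ring
    rw [e]
    exact mul_le_mul_of_nonneg_left (by linarith) hc.le

end Kernel

/-! ### The Kelvin transform of the integral equation -/

section Inversion

variable {n : ℕ}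

lemma hasFDerivAt_sphereInv {l : ℝ} {x : EuclideanSpace ℝ (Fin n)} (hx : x ≠ 0) :
    HasFDerivAt (sphereInv l)
      ((l / ‖x‖) ^ 2 • ((ℝ ∙ x)ᗮ.reflection :
        EuclideanSpace ℝ (Fin n) →L[ℝ] EuclideanSpace ℝ (Fin n))) x := by
  have h := EuclideanGeometry.hasFDerivAt_inversion (c := (0 : EuclideanSpace ℝ (Fin n)))
    (R := l) hx
  have e : EuclideanGeometry.inversion (0 : EuclideanSpace ℝ (Fin n)) l = sphereInv l := by
    ext1 y
    simp [EuclideanGeometry.inversion, sphereInv]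
  rw [e] at h
  simpa using h

lemma abs_det_fderiv_sphereInv (l : ℝ) (x : EuclideanSpace ℝ (Fin n)) :
    |((l / ‖x‖) ^ 2 • ((ℝ ∙ x)ᗮ.reflection :
        EuclideanSpace ℝ (Fin n) →L[ℝ] EuclideanSpace ℝ (Fin n))).det| = (l / ‖x‖) ^ (2 * n) := by
  have h1 : ((l / ‖x‖) ^ 2 • ((ℝ ∙ x)ᗮ.reflection :
        EuclideanSpace ℝ (Fin n) →L[ℝ] EuclideanSpace ℝ (Fin n))).det
      = ((l / ‖x‖) ^ 2) ^ n * LinearMap.det ((ℝ ∙ x)ᗮ.reflection.toLinearMap) := by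
    rw [ContinuousLinearMap.det, ContinuousLinearMap.toLinearMap_smul, LinearMap.det_smul,
      finrank_euclideanSpace_fin]
    rfl
  rw [h1, Submodule.det_reflection, abs_mul, abs_pow, abs_pow (-1 : ℝ), abs_neg, abs_one, one_pow,
    mul_one, abs_of_nonneg (by positivity : (0 : ℝ) ≤ (l / ‖x‖) ^ 2), pow_mul]

lemma injOn_sphereInv {l : ℝ} (hl : 0 < l) {s : Set (EuclideanSpace ℝ (Fin n))}
    (hs : ∀ x ∈ s, 0 < ‖x‖) : Set.InjOn (sphereInv l) s := by
  intro x hx y hy h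
  rw [← sphereInv_sphereInv hl (hs x hx), h, sphereInv_sphereInv hl (hs y hy)]

lemma integrableOn_sphereInv_image {l : ℝ} (hl : 0 < l) {s : Set (EuclideanSpace ℝ (Fin n))}
    (hsm : MeasurableSet s) (hs : ∀ x ∈ s, 0 < ‖x‖) (g : EuclideanSpace ℝ (Fin n) → ℝ) :
    IntegrableOn g (sphereInv l '' s) ↔
      IntegrableOn (fun y => (l / ‖y‖) ^ (2 * n) * g (sphereInv l y)) s := by
  rw [integrableOn_image_iff_integrableOn_abs_det_fderiv_smul volume hsm
    (fun x hx => (hasFDerivAt_sphereInv (norm_pos_iff.1 (hs x hx))).hasFDerivWithinAt)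
    (injOn_sphereInv hl hs)]
  simp only [abs_det_fderiv_sphereInv, smul_eq_mul]

lemma integral_sphereInv_image {l : ℝ} (hl : 0 < l) {s : Set (EuclideanSpace ℝ (Fin n))}
    (hsm : MeasurableSet s) (hs : ∀ x ∈ s, 0 < ‖x‖) (g : EuclideanSpace ℝ (Fin n) → ℝ) :
    ∫ y in sphereInv l '' s, g y = ∫ y in s, (l / ‖y‖) ^ (2 * n) * g (sphereInv l y) := by
  rw [integral_image_eq_integral_abs_det_fderiv_smul volume hsm
    (fun x hx => (hasFDerivAt_sphereInv (norm_pos_iff.1 (hs x hx))).hasFDerivWithinAt)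
    (injOn_sphereInv hl hs)]
  simp only [abs_det_fderiv_sphereInv, smul_eq_mul]

/-- The open annulus `{r < |x| < l}`. -/
def annulus (n : ℕ) (r l : ℝ) : Set (EuclideanSpace ℝ (Fin n)) := {x | r < ‖x‖ ∧ ‖x‖ < l}

lemma isOpen_annulus (r l : ℝ) : IsOpen (annulus n r l) :=
  (isOpen_lt continuous_const continuous_norm).inter (isOpen_lt continuous_norm continuous_const)

lemma isOpen_exteriorDomain (r : ℝ) : IsOpen (exteriorDomain n r) :=
  isOpen_lt continuous_const continuous_norm

lemma annulus_subset_exteriorDomain (r l : ℝ) : annulus n r l ⊆ exteriorDomain n r :=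
  fun _ h => h.1

/-- The integrand, on the annulus `{r < |y| < l}`, of the lower bound for `u_l(x) - u(x)`: the part
of the integral over `{l < |y| < l² / r}` has been folded onto the annulus by the inversion. -/
noncomputable def foldedIntegrand (n : ℕ) (α r c l : ℝ) (F : EuclideanSpace ℝ (Fin n) → ℝ)
    (x y : EuclideanSpace ℝ (Fin n)) : ℝ :=
  (l / ‖y‖) ^ (2 * n) * (kelvinKernel n α r c l x (sphereInv l y) * F (sphereInv l y))
    + kelvinKernel n α r c l x y * F y

lemma foldedIntegrand_integral_le {α r c l : ℝ} (hn : 0 < n) (hα : α ≤ n) (hr : 0 < r) (hc : 0 < c)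
    {F : EuclideanSpace ℝ (Fin n) → ℝ} (hF : ∀ y ∈ exteriorDomain n r, 0 ≤ F y)
    (hint : ∀ x ∈ exteriorDomain n r,
      IntegrableOn (fun y => exteriorGreen n α r c x y * F y) (exteriorDomain n r))
    {x : EuclideanSpace ℝ (Fin n)} (hx : x ∈ annulus n r l) :
    IntegrableOn (foldedIntegrand n α r c l F x) (annulus n r l) ∧
    ∫ y in annulus n r l, foldedIntegrand n α r c l F x y ≤
      (l / ‖x‖) ^ ((n : ℝ) - α) *
        (∫ y in exteriorDomain n r, exteriorGreen n α r c (sphereInv l x) y * F y)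
      - ∫ y in exteriorDomain n r, exteriorGreen n α r c x y * F y := by
  have : NeZero n := ⟨hn.ne'⟩
  obtain ⟨hxr, hxl⟩ := hx
  have hx0 : 0 < ‖x‖ := hr.trans hxr
  have hl0 : 0 < l := hx0.trans hxl
  have hrl : r < l := hxr.trans hxl
  have hix := lt_norm_sphereInv hx0 hxl
  have hpos : ∀ y ∈ annulus n r l, 0 < ‖y‖ := fun y hy => hr.trans hy.1
  have i1 := hint x hxr
  have i2 := (hint (sphereInv l x) (hrl.trans hix)).const_mul ((l / ‖x‖) ^ ((n : ℝ) - α))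
  have eK : (fun y => kelvinKernel n α r c l x y * F y) =
      fun y => (l / ‖x‖) ^ ((n : ℝ) - α) * (exteriorGreen n α r c (sphereInv l x) y * F y)
        - exteriorGreen n α r c x y * F y := by
    ext y; rw [kelvinKernel]; ring
  have iK : IntegrableOn (fun y => kelvinKernel n α r c l x y * F y) (exteriorDomain n r) := by
    rw [eK]; exact i2.sub i1
  have hA := (isOpen_annulus (n := n) r l).measurableSet
  have hsub' : sphereInv l '' annulus n r l ⊆ {y | l < ‖y‖} := by
    rintro _ ⟨y, hy, rfl⟩
    exact lt_norm_sphereInv (hpos y hy) hy.2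
  have hsub'' : sphereInv l '' annulus n r l ⊆ exteriorDomain n r :=
    hsub'.trans fun y hy => hrl.trans hy
  have hmeas' : MeasurableSet (sphereInv l '' annulus n r l) :=
    measurable_image_of_fderivWithin hA
      (fun x hx => (hasFDerivAt_sphereInv (norm_pos_iff.1 (hpos x hx))).hasFDerivWithinAt)
      (injOn_sphereInv hl0 hpos)
  have hdisj : Disjoint (sphereInv l '' annulus n r l) (annulus n r l) :=
    Set.disjoint_left.2 fun y hy hy' => lt_asymm (hsub' hy) hy'.2
  have iA := iK.mono_set (annulus_subset_exteriorDomain r l)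
  have iA' := iK.mono_set hsub''
  have iA'' := (integrableOn_sphereInv_image hl0 hA hpos _).1 iA'
  refine ⟨iA''.add iA, ?_⟩
  have e1 : ∫ y in annulus n r l, foldedIntegrand n α r c l F x y =
      ∫ y in sphereInv l '' annulus n r l ∪ annulus n r l, kelvinKernel n α r c l x y * F y := by
    rw [setIntegral_union hdisj hA iA' iA, integral_sphereInv_image hl0 hA hpos]
    exact integral_add iA'' iA
  have e2 : ∫ y in exteriorDomain n r, kelvinKernel n α r c l x y * F y
      = (l / ‖x‖) ^ ((n : ℝ) - α) *
        (∫ y in exteriorDomain n r, exteriorGreen n α r c (sphereInv l x) y * F y)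
      - ∫ y in exteriorDomain n r, exteriorGreen n α r c x y * F y := by
    rw [eK, integral_sub i2 i1, integral_const_mul]
  rw [e1, ← e2]
  have hU := hmeas'.union hA
  have hUs := Set.union_subset hsub'' (annulus_subset_exteriorDomain (n := n) r l)
  have e3 := setIntegral_union (Set.disjoint_sdiff_right)
    ((isOpen_exteriorDomain r).measurableSet.diff hU) (iK.mono_set hUs)
    (iK.mono_set (Set.sdiff_subset))
  rw [Set.union_sdiff_cancel hUs] at e3
  rw [e3]
  refine le_add_of_nonneg_right (setIntegral_nonneg_of_ae_restrict ?_)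
  have hm := (isOpen_exteriorDomain (n := n) r).measurableSet.diff hU
  rw [Filter.EventuallyLE, ae_restrict_iff' hm]
  have n1 : ∀ᵐ y : EuclideanSpace ℝ (Fin n), y ∉ Metric.sphere (0 : EuclideanSpace ℝ (Fin n)) l :=
    measure_eq_zero_iff_ae_notMem.1 (Measure.addHaar_sphere _ _ _)
  have n2 : ∀ᵐ y : EuclideanSpace ℝ (Fin n), y ∉ ({sphereInv l x} : Set _) :=
    measure_eq_zero_iff_ae_notMem.1 (measure_singleton _)
  filter_upwards [n1, n2] with y h1 h2 hy
  have hyl : l < ‖y‖ := by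
    have h3 : ¬ ‖y‖ < l := fun h => hy.2 (Or.inr ⟨hy.1, h⟩)
    have h4 : ‖y‖ ≠ l := by simpa using h1
    exact lt_of_le_of_ne (not_lt.1 h3) h4.symm
  exact mul_nonneg (kelvinKernel_nonneg hα hr hc hxr hxl hyl fun h => h2 h.symm) (hF y hy.1)

/-- The Kelvin transform of `u` in the sphere of radius `l`. -/
noncomputable def kelvinTransform (n : ℕ) (α l : ℝ) (u : EuclideanSpace ℝ (Fin n) → ℝ)
    (x : EuclideanSpace ℝ (Fin n)) : ℝ :=
  (l / ‖x‖) ^ ((n : ℝ) - α) * u (sphereInv l x)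

/-- Subcritical growth compares the Kelvin-transformed nonlinearity with the nonlinearity of the
Kelvin transform; both alternatives in the definition yield the same inequality. -/
lemma SubcriticalGrowth.lt_kelvin {α r l : ℝ} (hα : α ≤ n) (hr : 0 < r)
    {f : EuclideanSpace ℝ (Fin n) → ℝ → ℝ} (hf : SubcriticalGrowth n α r f)
    {u : EuclideanSpace ℝ (Fin n) → ℝ} {y : EuclideanSpace ℝ (Fin n)} (hy : y ∈ annulus n r l)
    (hu : 0 < u (sphereInv l y)) :
    f y (kelvinTransform n α l u y) <
      (l / ‖y‖) ^ ((n : ℝ) + α) * f (sphereInv l y) (u (sphereInv l y)) := by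
  obtain ⟨hyr, hyl⟩ := hy
  have hy0 : 0 < ‖y‖ := hr.trans hyr
  have hl0 : 0 < l := hy0.trans hyl
  have hiy := lt_norm_sphereInv hy0 hyl
  have hq1 : 1 < l / ‖y‖ := (one_lt_div hy0).2 hyl
  have hq0 : 0 < l / ‖y‖ := by positivity
  rcases hα.lt_or_eq with h | h
  · have ha : 0 < (n : ℝ) - α := by linarith
    set μ := (l / ‖y‖) ^ ((n : ℝ) - α) with hμ
    have hμ1 : 1 < μ := Real.one_lt_rpow hq1 ha
    have hμ0 : 0 < μ := by linarith
    have e1 : μ ^ (((n : ℝ) + α) / (n - α)) = (l / ‖y‖) ^ ((n : ℝ) + α) := by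
      rw [hμ, ← Real.rpow_mul hq0.le]; congr 1; field_simp
    have e2 : μ ^ (2 / ((n : ℝ) - α)) = (l / ‖y‖) ^ 2 := by
      rw [hμ, ← Real.rpow_mul hq0.le, ← Real.rpow_natCast]; congr 1; push_cast; field_simp
    have hk : 0 < kelvinTransform n α l u y := mul_pos hμ0 hu
    have e3 : μ⁻¹ * kelvinTransform n α l u y = u (sphereInv l y) := by
      rw [kelvinTransform, ← hμ, inv_mul_cancel_left₀ hμ0.ne']
    rcases hf.1 h with H | H
    · have := H y hyr _ hk (a := 1) (b := μ) (show (1 : ℝ) ≤ 1 from le_rfl) hμ1.le hμ1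
      simp only [e1, e2, e3, Real.one_rpow, one_smul, inv_one, one_mul] at this
      exact this
    · have e4 : (μ⁻¹) ^ (2 / ((n : ℝ) - α)) • sphereInv l y = y := by
        rw [Real.inv_rpow hμ0.le, e2, sphereInv, smul_smul, inv_mul_cancel₀ (by positivity),
          one_smul]
      have := H (sphereInv l y) (by show r < _; linarith) _ hu (a := μ⁻¹) (b := 1)
        ⟨by positivity, (inv_lt_one_of_one_lt₀ hμ1).le, by rw [e4]; exact hyr⟩
        ⟨one_pos, le_rfl, by rw [Real.one_rpow, one_smul]; show r < _; linarith⟩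
        (inv_lt_one_of_one_lt₀ hμ1)
      simp only [e4, Real.one_rpow, one_smul, inv_one, one_mul, inv_inv] at this
      rw [Real.inv_rpow hμ0.le, e1, inv_mul_lt_iff₀ (by positivity)] at this
      exact this
  · have ek : kelvinTransform n α l u y = u (sphereInv l y) := by
      rw [kelvinTransform, h, sub_self, Real.rpow_zero, one_mul]
    have hμ1 : 1 < (l / ‖y‖) ^ 2 := one_lt_pow₀ hq1 two_ne_zero
    have e1 : ((l / ‖y‖) ^ 2) ^ n = (l / ‖y‖) ^ ((n : ℝ) + α) := by
      rw [h, ← pow_mul, ← Real.rpow_natCast]; congr 1; push_cast; ring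
    rw [ek]
    rcases hf.2 h with H | H
    · have := H y hyr _ hu (a := 1) (b := (l / ‖y‖) ^ 2) (show (1 : ℝ) ≤ 1 from le_rfl) hμ1.le hμ1
      simp only [e1, one_smul, one_mul, one_pow] at this
      exact this
    · have e4 : ((l / ‖y‖) ^ 2)⁻¹ • sphereInv l y = y := by
        rw [sphereInv, smul_smul, inv_mul_cancel₀ (by positivity), one_smul]
      have := H (sphereInv l y) (by show r < _; linarith) _ hu (a := ((l / ‖y‖) ^ 2)⁻¹) (b := 1)
        ⟨by positivity, (inv_lt_one_of_one_lt₀ hμ1).le, by rw [e4]; exact hyr⟩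
        ⟨one_pos, le_rfl, by rw [one_smul]; show r < _; linarith⟩
        (inv_lt_one_of_one_lt₀ hμ1)
      simp only [e4, one_smul, one_mul, one_pow] at this
      rw [inv_pow, e1, inv_mul_lt_iff₀ (by positivity)] at this
      exact this

/-- Pointwise lower bound for the folded integrand, in terms of a positive kernel and the gap in
the nonlinearity. -/
lemma foldedIntegrand_gt {α r c l : ℝ} (hα : α ≤ n) (hr : 0 < r) (hc : 0 < c)
    {F : EuclideanSpace ℝ (Fin n) → ℝ} {x y : EuclideanSpace ℝ (Fin n)}
    (hx : x ∈ annulus n r l) (hy : y ∈ annulus n r l) (hxy : x ≠ y) (hFy : 0 ≤ F y) {v : ℝ}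
    (hv : v < (l / ‖y‖) ^ ((n : ℝ) + α) * F (sphereInv l y)) :
    (l / ‖y‖) ^ ((n : ℝ) - α) * kelvinKernel n α r c l x (sphereInv l y) * (v - F y)
      < foldedIntegrand n α r c l F x y := by
  obtain ⟨h1, h2, -⟩ := kelvinKernel_reflected hα hr hc hx.1 hx.2 hy.1 hy.2 hxy
  have hy0 : 0 < ‖y‖ := hr.trans hy.1
  have hl0 : 0 < l := hy0.trans hy.2
  have e : (l / ‖y‖) ^ (2 * n) = (l / ‖y‖) ^ ((n : ℝ) - α) * (l / ‖y‖) ^ ((n : ℝ) + α) := by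
    rw [← Real.rpow_add (by positivity), ← Real.rpow_natCast]; congr 1; push_cast; ring
  rw [foldedIntegrand, e]
  have := mul_lt_mul_of_pos_left hv h1
  have := mul_nonneg h2.le hFy
  linarith

end Inversion

/-! ### Singular integrals over thin sets -/

section Singular

variable {n : ℕ}

lemma integrableOn_dist_inner_sphere_rpow (hn : 0 < n) {r b γ : ℝ} (hr : 0 < r) (hγ : γ < 1) :
    IntegrableOn (fun y : EuclideanSpace ℝ (Fin n) => (‖y‖ - r) ^ (-γ)) (annulus n r b) := by
  have : NeZero n := ⟨hn.ne'⟩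
  rcases le_or_gt b r with hbr | hbr
  · have : annulus n r b = ∅ := by
      ext y; simp only [annulus, Set.mem_ofPred_eq, Set.mem_empty_iff_false, iff_false]
      rintro ⟨h1, h2⟩; linarith
    rw [this]; exact integrableOn_empty
  have h1 : IntegrableOn (fun t : ℝ => (t - r) ^ (-γ)) (Set.Ioo r b) := by
    have h0 := (intervalIntegral.intervalIntegrable_rpow' (a := 0) (b := b - r)
      (by linarith : -1 < -γ)).comp_sub_right r
    simp only [zero_add, sub_add_cancel] at h0
    rw [intervalIntegrable_iff_integrableOn_Ioo_of_le hbr.le] at h0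
    exact h0
  have h2 : IntegrableOn (fun t : ℝ => t ^ (n - 1) * (t - r) ^ (-γ)) (Set.Ioo r b) := by
    refine h1.bdd_mul (c := b ^ (n - 1)) (by fun_prop) ?_
    filter_upwards [ae_restrict_mem measurableSet_Ioo] with t ht
    rw [Real.norm_of_nonneg (pow_nonneg (hr.le.trans ht.1.le) _)]
    exact pow_le_pow_left₀ (hr.le.trans ht.1.le) ht.2.le _
  have h3 : Integrable (fun y : EuclideanSpace ℝ (Fin n) =>
      (Set.Ioo r b).indicator (fun t => (t - r) ^ (-γ)) ‖y‖) := by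
    rw [integrable_fun_norm_addHaar volume (f := (Set.Ioo r b).indicator (fun t => (t - r) ^ (-γ))),
      finrank_euclideanSpace_fin]
    have : (fun y : ℝ => y ^ (n - 1) • (Set.Ioo r b).indicator (fun t => (t - r) ^ (-γ)) y)
        = (Set.Ioo r b).indicator (fun t : ℝ => t ^ (n - 1) * (t - r) ^ (-γ)) := by
      ext y; by_cases h : y ∈ Set.Ioo r b <;> simp [h]
    rw [this]
    exact ((integrable_indicator_iff measurableSet_Ioo).2 h2).integrableOn
  rw [← integrable_indicator_iff (isOpen_annulus r b).measurableSet]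
  refine h3.congr (Filter.Eventually.of_forall fun y => ?_)
  by_cases h : y ∈ annulus n r b
  · simp only [Set.indicator_of_mem h]
    rw [Set.indicator_of_mem (show ‖y‖ ∈ Set.Ioo r b from h)]
  · simp only [Set.indicator_of_notMem h]
    rw [Set.indicator_of_notMem (show ‖y‖ ∉ Set.Ioo r b from h)]

lemma exists_forall_integral_norm_sub_rpow_le (hn : 0 < n) {r b ν : ℝ} (hν : ν < n) :
    ∃ M : ℝ, 0 ≤ M ∧ ∀ x ∈ annulus n r b, ∀ Q ⊆ annulus n r b, MeasurableSet Q →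
      IntegrableOn (fun y => ‖x - y‖ ^ (-ν)) Q ∧ ∫ y in Q, ‖x - y‖ ^ (-ν) ≤ M := by
  have h1 : IntegrableOn (fun z : EuclideanSpace ℝ (Fin n) => ‖z‖ ^ (-ν))
      (Metric.ball 0 (2 * b)) := by
    refine integrableOn_ball_of_norm_le_rpow (C := 1) (α := ν) ?_ ?_ ?_ ?_
    · rw [finrank_euclideanSpace_fin]; exact hn
    · rw [finrank_euclideanSpace_fin]; exact hν
    · refine Filter.Eventually.of_forall fun x => ?_
      rw [Real.norm_of_nonneg (by positivity), one_mul]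
    · exact (by fun_prop : Measurable fun z : EuclideanSpace ℝ (Fin n) =>
        ‖z‖ ^ (-ν)).aestronglyMeasurable
  rw [← integrable_indicator_iff measurableSet_ball] at h1
  set ψ := (Metric.ball (0 : EuclideanSpace ℝ (Fin n)) (2 * b)).indicator
    (fun z : EuclideanSpace ℝ (Fin n) => ‖z‖ ^ (-ν)) with hψ
  have hψ0 : ∀ z, 0 ≤ ψ z := fun z => Set.indicator_nonneg (fun _ _ => by positivity) z
  refine ⟨∫ z, ψ z, integral_nonneg hψ0, fun x hx Q hQ hQm => ?_⟩
  have h2 := h1.comp_sub_left x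
  have e : Set.EqOn (fun y => ψ (x - y)) (fun y => ‖x - y‖ ^ (-ν)) Q := by
    intro y hy
    have : x - y ∈ Metric.ball (0 : EuclideanSpace ℝ (Fin n)) (2 * b) := by
      rw [mem_ball_zero_iff]
      have := norm_sub_le x y
      have := hx.2
      have := (hQ hy).2
      linarith
    simp only [hψ, Set.indicator_of_mem this]
  refine ⟨h2.integrableOn.congr_fun e hQm, ?_⟩
  rw [← setIntegral_congr_fun hQm e, ← integral_sub_left_eq_self ψ volume x]
  exact setIntegral_le_integral h2 (Filter.Eventually.of_forall fun y => hψ0 _)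

/-- Splitting a product of singularities, of order `θ` at an `(n-1)`-dimensional and of order `β` at
a `0`-dimensional set, into a sum. -/
lemma rpow_mul_rpow_le_add (hn : 0 < n) {θ β η ρ d : ℝ} (hθ : 0 < θ) (hβ : 0 < β) (hη : 0 < η)
    (hρ : 0 < ρ) (hd : 0 < d) :
    ρ ^ (-θ) * d ^ (-β) ≤
      η ^ (-β) * ρ ^ (-(β / n + θ)) + η ^ (n * θ) * d ^ (-(n * (β / n + θ))) := by
  have hn' : (0 : ℝ) < n := by exact_mod_cast hn
  -- The threshold `d = η * ρ ^ (1 / n)` converts one singularity into the other.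
  rcases le_or_gt (η * ρ ^ (1 / (n : ℝ))) d with h | h
  · have h1 : d ^ (-β) ≤ (η * ρ ^ (1 / (n : ℝ))) ^ (-β) :=
      Real.rpow_le_rpow_of_nonpos (by positivity) h (by linarith)
    have h2 : (η * ρ ^ (1 / (n : ℝ))) ^ (-β) = η ^ (-β) * ρ ^ (-(β / n)) := by
      rw [Real.mul_rpow hη.le (by positivity), ← Real.rpow_mul hρ.le]
      congr 2; field_simp
    calc ρ ^ (-θ) * d ^ (-β) ≤ ρ ^ (-θ) * (η ^ (-β) * ρ ^ (-(β / n))) := by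
          rw [← h2]; gcongr
      _ = η ^ (-β) * ρ ^ (-(β / n + θ)) := by
          rw [neg_add, Real.rpow_add hρ]; ring
      _ ≤ _ := le_add_of_nonneg_right (by positivity)
  · have h0 : d / η < ρ ^ (1 / (n : ℝ)) := by rw [div_lt_iff₀ hη]; linarith
    have h1 : (ρ ^ (1 / (n : ℝ))) ^ (-(n * θ)) ≤ (d / η) ^ (-(n * θ)) :=
      Real.rpow_le_rpow_of_nonpos (by positivity) h0.le (by nlinarith)
    have h2 : (ρ ^ (1 / (n : ℝ))) ^ (-(n * θ)) = ρ ^ (-θ) := by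
      rw [← Real.rpow_mul hρ.le]; congr 1; field_simp
    have h3 : (d / η) ^ (-(n * θ)) = η ^ (n * θ) * d ^ (-(n * θ)) := by
      rw [div_eq_mul_inv, Real.mul_rpow hd.le (by positivity), Real.inv_rpow hη.le,
        Real.rpow_neg hη.le, inv_inv, mul_comm]
    rw [h2, h3] at h1
    calc ρ ^ (-θ) * d ^ (-β) ≤ (η ^ (n * θ) * d ^ (-(n * θ))) * d ^ (-β) := by gcongr
      _ = η ^ (n * θ) * d ^ (-(n * (β / n + θ))) := by
          rw [mul_assoc, ← Real.rpow_add hd]; congr 2; field_simp; ring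
      _ ≤ _ := le_add_of_nonneg_left (by positivity)

/-- The integral of the product of the two singularities over a subset of an annulus is small,
uniformly in the position of the point singularity, if the integral of a suitable integrable
function of the distance to the inner sphere is. -/
lemma exists_forall_singular_integral_le (hn : 0 < n) {r b θ β ε : ℝ} (hr : 0 < r) (hθ : 0 < θ)
    (hβ : 0 < β) (hβθ : β / n + θ < 1) (hε : 0 < ε) :
    ∃ C : ℝ, 0 ≤ C ∧ ∀ x ∈ annulus n r b, ∀ Q ⊆ annulus n r b, MeasurableSet Q →
      IntegrableOn (fun y => (‖y‖ - r) ^ (-θ) * ‖x - y‖ ^ (-β)) Q ∧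
      ∫ y in Q, (‖y‖ - r) ^ (-θ) * ‖x - y‖ ^ (-β) ≤
        C * (∫ y in Q, (‖y‖ - r) ^ (-(β / n + θ))) + ε := by
  have : NeZero n := ⟨hn.ne'⟩
  have hn' : (0 : ℝ) < n := by exact_mod_cast hn
  obtain ⟨M, hM0, hM⟩ := exists_forall_integral_norm_sub_rpow_le (n := n) (r := r) (b := b) hn
    (ν := n * (β / n + θ)) (by nlinarith)
  set η := (ε / (M + 1)) ^ (1 / (n * θ)) with hη
  have hη0 : 0 < η := by positivity
  have hη1 : η ^ (n * θ) = ε / (M + 1) := by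
    rw [hη, ← Real.rpow_mul (by positivity), one_div_mul_cancel (by positivity), Real.rpow_one]
  have hη2 : η ^ (n * θ) * M ≤ ε := by
    rw [hη1, div_mul_eq_mul_div, div_le_iff₀ (by linarith)]; nlinarith
  refine ⟨η ^ (-β), by positivity, fun x hx Q hQ hQm => ?_⟩
  obtain ⟨i1, hi1⟩ := hM x hx Q hQ hQm
  have i2 : IntegrableOn (fun y : EuclideanSpace ℝ (Fin n) => (‖y‖ - r) ^ (-(β / n + θ))) Q :=
    (integrableOn_dist_inner_sphere_rpow hn hr hβθ).mono_set hQ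
  have i3 := (i2.const_mul (η ^ (-β))).add (i1.const_mul (η ^ (n * θ)))
  have hne : ∀ᵐ y : EuclideanSpace ℝ (Fin n), y ∉ ({x} : Set _) :=
    measure_eq_zero_iff_ae_notMem.1 (measure_singleton _)
  have hle : ∀ᵐ y ∂(volume.restrict Q), (‖y‖ - r) ^ (-θ) * ‖x - y‖ ^ (-β) ≤
      η ^ (-β) * (‖y‖ - r) ^ (-(β / n + θ)) + η ^ (n * θ) * ‖x - y‖ ^ (-(n * (β / n + θ))) := by
    rw [ae_restrict_iff' hQm]
    filter_upwards [hne] with y h1 h2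
    refine rpow_mul_rpow_le_add hn hθ hβ hη0 (sub_pos.2 (hQ h2).1) ?_
    exact norm_pos_iff.2 (sub_ne_zero.2 fun h => h1 h.symm)
  have i4 : IntegrableOn (fun y => (‖y‖ - r) ^ (-θ) * ‖x - y‖ ^ (-β)) Q := by
    refine i3.mono' (by fun_prop : Measurable fun y : EuclideanSpace ℝ (Fin n) =>
      (‖y‖ - r) ^ (-θ) * ‖x - y‖ ^ (-β)).aestronglyMeasurable ?_
    filter_upwards [hle, ae_restrict_mem hQm] with y h1 h2
    have : 0 < ‖y‖ - r := sub_pos.2 (hQ h2).1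
    rw [Real.norm_of_nonneg (by positivity)]
    exact h1
  refine ⟨i4, ?_⟩
  calc ∫ y in Q, (‖y‖ - r) ^ (-θ) * ‖x - y‖ ^ (-β) ≤ _ := setIntegral_mono_ae_restrict i4 i3 hle
    _ = η ^ (-β) * (∫ y in Q, (‖y‖ - r) ^ (-(β / n + θ)))
        + η ^ (n * θ) * ∫ y in Q, ‖x - y‖ ^ (-(n * (β / n + θ))) := by
      simp only [Pi.add_apply]
      rw [integral_add (i2.const_mul (η ^ (-β))) (i1.const_mul (η ^ (n * θ))), integral_const_mul,
        integral_const_mul]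
    _ ≤ _ := by
      have := mul_le_mul_of_nonneg_left hi1 (by positivity : 0 ≤ η ^ (n * θ))
      linarith

/-- Exponents for the two singularities. In the critical case the logarithmic singularity of the
kernel is replaced by a small power. -/
lemma exists_singular_exponents (hn : 0 < n) {α θ : ℝ} (hα : 0 < α) (hαn : α ≤ n)
    (hθ : θ < α / n) :
    ∃ θ' β : ℝ, 0 < θ' ∧ θ ≤ θ' ∧ 0 < β ∧ β / n + θ' < 1 ∧ ((n : ℝ) - α = 0 ∨ β = n - α) := by
  have hn' : (0 : ℝ) < n := by exact_mod_cast hn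
  obtain ⟨θ', h1, h2⟩ := exists_between (max_lt hθ (by positivity : 0 < α / n))
  obtain ⟨h3, h4⟩ := max_lt_iff.1 h1
  rcases hαn.eq_or_lt with h | h
  · have h5 : θ' < 1 := by rwa [h, div_self hn'.ne'] at h2
    refine ⟨θ', n * (1 - θ') / 2, h4, h3.le, by nlinarith, ?_, Or.inl (by linarith)⟩
    have : n * (1 - θ') / 2 / n = (1 - θ') / 2 := by field_simp
    rw [this]; linarith
  · refine ⟨θ', n - α, h4, h3.le, by linarith, ?_, Or.inr rfl⟩
    rw [sub_div, div_self hn'.ne']; linarith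

/-- The bound in `kelvinKernel_reflected` has at most the power singularity of order `β`, uniformly in the radius;
the order `β` is arbitrary if the kernel is logarithmic. -/
lemma exists_rieszProfile_sub_le {a β r b : ℝ} (hr : 0 < r) (hβ : 0 < β)
    (h : a = 0 ∨ β = a) :
    ∃ C : ℝ, 0 ≤ C ∧ ∀ l : ℝ, 0 < l → l ≤ b → ∀ d : ℝ, 0 < d →
      rieszProfile a (d ^ 2) - rieszProfile a ((r + l ^ 2 / r) ^ 2) ≤ C * d ^ (-β) := by
  by_cases ha : a = 0
  · refine ⟨(r + b ^ 2 / r) ^ β / β, by positivity, fun l hl hlb d hd => ?_⟩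
    have hR : 0 < r + l ^ 2 / r := by positivity
    have hR' : r + l ^ 2 / r ≤ r + b ^ 2 / r := by gcongr
    rw [rieszProfile_sq _ hd, rieszProfile_sq _ hR, if_pos ha, if_pos ha, one_div, one_div,
      Real.log_inv, Real.log_inv]
    calc -Real.log d - -Real.log (r + l ^ 2 / r) = Real.log ((r + l ^ 2 / r) / d) := by
          rw [Real.log_div hR.ne' hd.ne']; ring
      _ ≤ ((r + l ^ 2 / r) / d) ^ β / β := Real.log_le_rpow_div (by positivity) hβ
      _ = (r + l ^ 2 / r) ^ β / β * d ^ (-β) := by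
          rw [Real.div_rpow hR.le hd.le, Real.rpow_neg hd.le]; ring
      _ ≤ _ := by gcongr
  · obtain rfl : β = a := h.resolve_left ha
    refine ⟨1, zero_le_one, fun l hl hlb d hd => ?_⟩
    have hR : 0 < r + l ^ 2 / r := by positivity
    rw [rieszProfile_sq _ hd, rieszProfile_sq _ hR, if_neg ha, if_neg ha, one_mul,
      Real.rpow_neg hd.le, one_div]
    have : 0 < 1 / (r + l ^ 2 / r) ^ β := by positivity
    linarith

/-- On compact ranges of values, a locally Lipschitz function is Lipschitz. -/
lemma LocallyLipschitzInU.exists_forall_sub_le {r : ℝ} {g : EuclideanSpace ℝ (Fin n) → ℝ → ℝ}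
    (hg : LocallyLipschitzInU n r g) {ω : Set (EuclideanSpace ℝ (Fin n))}
    (hω : ω ⊆ exteriorDomain n r) (hωb : Bornology.IsBounded ω) {M : ℝ} (hM : 0 ≤ M) :
    ∃ K : ℝ, 0 ≤ K ∧ ∀ x ∈ ω, ∀ v w : ℝ, 0 ≤ v → v ≤ w → w ≤ M → g x w - g x v ≤ K * (w - v) := by
  choose V hVo hV K hK using fun i : Set.Icc (0 : ℝ) M => hg i i.2.1 ω hω hωb
  obtain ⟨t, ht0, htm, ⟨m, hm⟩, ht⟩ := exists_monotone_Icc_subset_open_cover_Icc hM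
    (c := fun i : Set.Icc (0 : ℝ) M => Subtype.val ⁻¹' V i)
    (fun i => (hVo i).preimage continuous_subtype_val)
    (fun i _ => Set.mem_iUnion.2 ⟨i, hV i⟩)
  have key : ∀ k, ∃ K : ℝ, 0 ≤ K ∧ ∀ x ∈ ω, ∀ v w : ℝ, 0 ≤ v → v ≤ w → w ≤ t k →
      g x w - g x v ≤ K * (w - v) := by
    intro k
    induction k with
    | zero =>
      refine ⟨0, le_rfl, fun x _ v w hv hvw hw => ?_⟩
      rw [ht0] at hw
      have : v = w := by linarith
      simp [this]
    | succ k ih =>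
      obtain ⟨K₁, hK₁, h₁⟩ := ih
      obtain ⟨i, hi⟩ := ht k
      have h₂ : ∀ x ∈ ω, ∀ v w : ℝ, t k ≤ v → v ≤ w → w ≤ t (k + 1) →
          g x w - g x v ≤ K i * (w - v) := by
        intro x hx v w hv hvw hw
        have hv0 : 0 ≤ v := (t k).2.1.trans hv
        have hwM : w ≤ M := hw.trans (t (k + 1)).2.2
        have mv : v ∈ V i := hi (a := ⟨v, hv0, hvw.trans hwM⟩) ⟨hv, hvw.trans hw⟩
        have mw : w ∈ V i := hi (a := ⟨w, hv0.trans hvw, hwM⟩) ⟨hv.trans hvw, hw⟩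
        have := (hK i x hx).dist_le_mul w ⟨mw, hv0.trans hvw⟩ v ⟨mv, hv0⟩
        rw [Real.dist_eq, Real.dist_eq, abs_of_nonneg (sub_nonneg.2 hvw)] at this
        exact (le_abs_self _).trans this
      refine ⟨max K₁ (K i), hK₁.trans (le_max_left _ _), fun x hx v w hv hvw hw => ?_⟩
      have m1 := le_max_left K₁ (K i : ℝ)
      have m2 := le_max_right K₁ (K i : ℝ)
      rcases le_total w (t k) with hwt | hwt
      · exact (h₁ x hx v w hv hvw hwt).trans
          (mul_le_mul_of_nonneg_right m1 (sub_nonneg.2 hvw))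
      rcases le_total (t k : ℝ) v with hvt | hvt
      · exact (h₂ x hx v w hvt hvw hw).trans
          (mul_le_mul_of_nonneg_right m2 (sub_nonneg.2 hvw))
      · have a1 := h₁ x hx v (t k) hv hvt le_rfl
        have a2 := h₂ x hx (t k) w le_rfl hwt hw
        have b1 := mul_le_mul_of_nonneg_right m1 (sub_nonneg.2 hvt)
        have b2 := mul_le_mul_of_nonneg_right m2 (sub_nonneg.2 hwt)
        linarith
  obtain ⟨K, hK0, h⟩ := key m
  refine ⟨K, hK0, fun x hx v w hv hvw hw => h x hx v w hv hvw ?_⟩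
  rw [hm m le_rfl]; exact hw

/-- Only the one-sided difference, without absolute value, enters the comparison of `u` with its
Kelvin transform. The weight may be strengthened because the annulus is bounded. -/
lemma exists_forall_weighted_lipschitz {r b M θ θ' : ℝ}
    {f : EuclideanSpace ℝ (Fin n) → ℝ → ℝ}
    (hf : LocallyLipschitzInU n r fun x u => (‖x‖ - r) ^ θ * f x u) (hθ : θ ≤ θ') (hM : 0 ≤ M) :
    ∃ K : ℝ, 0 ≤ K ∧ ∀ y ∈ annulus n r b, ∀ v w : ℝ, 0 ≤ v → v ≤ w → w ≤ M →
      f y w - f y v ≤ K * (‖y‖ - r) ^ (-θ') * (w - v) := by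
  obtain ⟨K, hK0, hK⟩ := hf.exists_forall_sub_le (annulus_subset_exteriorDomain r b)
    ((Metric.isBounded_ball (x := (0 : EuclideanSpace ℝ (Fin n))) (r := b)).subset
      fun y hy => by rw [mem_ball_zero_iff]; exact hy.2) hM
  refine ⟨K * |b - r| ^ (θ' - θ), by positivity, fun y hy v w hv hvw hw => ?_⟩
  have hρ : 0 < ‖y‖ - r := sub_pos.2 hy.1
  have h := hK y hy v w hv hvw hw
  have h' : f y w - f y v ≤ K * (‖y‖ - r) ^ (-θ) * (w - v) := by
    rw [Real.rpow_neg hρ.le]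
    have hp : 0 < (‖y‖ - r) ^ θ := by positivity
    rw [mul_right_comm, ← div_eq_mul_inv, le_div_iff₀ hp]
    linarith
  refine h'.trans (mul_le_mul_of_nonneg_right ?_ (sub_nonneg.2 hvw))
  have e : (‖y‖ - r) ^ (-θ) = (‖y‖ - r) ^ (θ' - θ) * (‖y‖ - r) ^ (-θ') := by
    rw [← Real.rpow_add hρ]; congr 1; ring
  rw [e, mul_assoc]
  have : ‖y‖ - r ≤ |b - r| := (by have := hy.2; linarith : ‖y‖ - r ≤ b - r).trans (le_abs_self _)
  have h0 : 0 ≤ θ' - θ := by linarith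
  gcongr

end Singular

/-! ### The method of scaling spheres -/

section ScalingSpheres

variable {n : ℕ}

/-- The standing assumptions of the method of scaling spheres: a solution of the integral equation
which is positive in the exterior domain. -/
structure IsPositiveSolution (n : ℕ) (α r c : ℝ) (f : EuclideanSpace ℝ (Fin n) → ℝ → ℝ)
    (u : EuclideanSpace ℝ (Fin n) → ℝ) : Prop where
  dim_pos : 0 < n
  order_pos : 0 < α
  order_le : α ≤ n
  radius_pos : 0 < r
  const_pos : 0 < c
  nonneg : ∀ x ∈ exteriorDomain n r, ∀ v : ℝ, 0 ≤ v → 0 ≤ f x v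
  growth : SubcriticalGrowth n α r f
  mono : AssumptionF1 n r f
  lipschitz : AssumptionF2 n α r f
  cont : ContinuousOn u (closure (exteriorDomain n r))
  pos : ∀ x ∈ exteriorDomain n r, 0 < u x
  sol : IsIntegralSolution n α r c f u

lemma mem_closure_exteriorDomain {r : ℝ} (hr : 0 < r) {x : EuclideanSpace ℝ (Fin n)}
    (hx : r ≤ ‖x‖) : x ∈ closure (exteriorDomain n r) := by
  have h : Tendsto (fun t : ℝ => t • x) (𝓝[>] 1) (𝓝 x) := by
    have : Tendsto (fun t : ℝ => t • x) (𝓝 1) (𝓝 ((1 : ℝ) • x)) :=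
      (continuous_id.smul continuous_const).tendsto 1
    rw [one_smul] at this
    exact this.mono_left nhdsWithin_le_nhds
  refine mem_closure_of_tendsto h ?_
  filter_upwards [self_mem_nhdsWithin] with t ht
  have ht' : (1 : ℝ) < t := ht
  show r < ‖t • x‖
  rw [norm_smul, Real.norm_of_nonneg (by linarith)]
  nlinarith

namespace IsPositiveSolution

variable {α r c : ℝ} {f : EuclideanSpace ℝ (Fin n) → ℝ → ℝ} {u : EuclideanSpace ℝ (Fin n) → ℝ}

lemma contOn (h : IsPositiveSolution n α r c f u) : ContinuousOn u (exteriorDomain n r) :=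
  h.cont.mono subset_closure

lemma exists_bound (h : IsPositiveSolution n α r c f u) (b : ℝ) :
    ∃ M : ℝ, 0 ≤ M ∧ ∀ x ∈ annulus n r b, u x ≤ M := by
  have hK : IsCompact (Metric.closedBall (0 : EuclideanSpace ℝ (Fin n)) b ∩ {x | r ≤ ‖x‖}) :=
    (isCompact_closedBall _ _).inter_right (isClosed_le continuous_const continuous_norm)
  obtain ⟨M, hM⟩ := hK.exists_bound_of_continuousOn
    (h.cont.mono fun x hx => mem_closure_exteriorDomain h.radius_pos hx.2)
  refine ⟨max M 0, le_max_right _ _, fun x hx => ?_⟩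
  refine ((le_abs_self _).trans (hM x ⟨?_, hx.1.le⟩)).trans (le_max_left _ _)
  rw [mem_closedBall_zero_iff]; exact hx.2.le

lemma sphereInv_mem (h : IsPositiveSolution n α r c f u) {l : ℝ}
    {x : EuclideanSpace ℝ (Fin n)} (hx : x ∈ annulus n r l) :
    sphereInv l x ∈ exteriorDomain n r :=
  (hx.1.trans hx.2).trans (lt_norm_sphereInv (h.radius_pos.trans hx.1) hx.2)

lemma kelvin_pos (h : IsPositiveSolution n α r c f u) {l : ℝ} {x : EuclideanSpace ℝ (Fin n)}
    (hx : x ∈ annulus n r l) : 0 < kelvinTransform n α l u x := by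
  have h0 := h.radius_pos.trans hx.1
  have h1 := h0.trans hx.2
  exact mul_pos (by positivity) (h.pos _ (h.sphereInv_mem hx))

lemma kelvin_continuousOn (h : IsPositiveSolution n α r c f u) (l : ℝ) :
    ContinuousOn (kelvinTransform n α l u) (annulus n r l) := by
  have hd : ContinuousOn (fun x : EuclideanSpace ℝ (Fin n) => l / ‖x‖) (annulus n r l) :=
    continuousOn_const.div continuous_norm.continuousOn
      fun x hx => (h.radius_pos.trans hx.1).ne'
  refine ContinuousOn.mul (hd.rpow_const fun x hx => Or.inl ?_) ?_
  · have h0 := h.radius_pos.trans hx.1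
    exact (div_pos (h0.trans hx.2) h0).ne'
  · exact h.contOn.comp ((hd.pow 2).smul continuousOn_id) fun x hx => h.sphereInv_mem hx

lemma kelvin_continuousAt (h : IsPositiveSolution n α r c f u) {l : ℝ}
    {x : EuclideanSpace ℝ (Fin n)} (hx : x ∈ annulus n r l) :
    ContinuousAt (fun l' => kelvinTransform n α l' u x) l := by
  have h0 := h.radius_pos.trans hx.1
  have hd : ContinuousAt (fun l' : ℝ => l' / ‖x‖) l := continuousAt_id.div_const _
  refine ContinuousAt.mul (hd.rpow_const (Or.inl (div_pos (h0.trans hx.2) h0).ne')) ?_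
  have h1 : ContinuousAt u (sphereInv l x) :=
    h.contOn.continuousAt ((isOpen_exteriorDomain r).mem_nhds (h.sphereInv_mem hx))
  exact ContinuousAt.comp (f := fun l' => sphereInv l' x) h1 ((hd.pow 2).smul continuousAt_const)

lemma integral_folded_le (h : IsPositiveSolution n α r c f u) {l : ℝ}
    {x : EuclideanSpace ℝ (Fin n)} (hx : x ∈ annulus n r l) :
    IntegrableOn (foldedIntegrand n α r c l (fun y => f y (u y)) x) (annulus n r l) ∧
    ∫ y in annulus n r l, foldedIntegrand n α r c l (fun y => f y (u y)) x y ≤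
      kelvinTransform n α l u x - u x := by
  have := foldedIntegrand_integral_le h.dim_pos h.order_le h.radius_pos h.const_pos
    (F := fun y => f y (u y)) (fun y hy => h.nonneg y hy _ (h.pos y hy).le)
    (fun x hx => (h.sol x hx).1) hx
  rwa [← (h.sol x hx.1).2, ← (h.sol _ (h.sphereInv_mem hx)).2] at this

lemma folded_gt (h : IsPositiveSolution n α r c f u) {l : ℝ}
    {x y : EuclideanSpace ℝ (Fin n)} (hx : x ∈ annulus n r l) (hy : y ∈ annulus n r l)
    (hxy : x ≠ y) :
    (l / ‖y‖) ^ ((n : ℝ) - α) * kelvinKernel n α r c l x (sphereInv l y) *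
        (f y (kelvinTransform n α l u y) - f y (u y))
      < foldedIntegrand n α r c l (fun y => f y (u y)) x y :=
  foldedIntegrand_gt (F := fun y => f y (u y)) h.order_le h.radius_pos h.const_pos hx hy hxy
    (h.nonneg y hy.1 _ (h.pos y hy.1).le)
    (h.growth.lt_kelvin h.order_le h.radius_pos hy (h.pos _ (h.sphereInv_mem hy)))

/-- If `u ≤ u_l` in the annulus, then the inequality is strict. -/
lemma lt_kelvin_of_le (h : IsPositiveSolution n α r c f u) {l : ℝ}
    (hl : ∀ x ∈ annulus n r l, u x ≤ kelvinTransform n α l u x) :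
    ∀ x ∈ annulus n r l, u x < kelvinTransform n α l u x := by
  have : NeZero n := ⟨h.dim_pos.ne'⟩
  intro x hx
  obtain ⟨hi, hle⟩ := h.integral_folded_le hx
  have hpos : ∀ y ∈ annulus n r l, x ≠ y →
      0 < foldedIntegrand n α r c l (fun y => f y (u y)) x y := by
    intro y hy hxy
    refine lt_of_le_of_lt (mul_nonneg ?_ ?_) (h.folded_gt hx hy hxy)
    · exact (kelvinKernel_reflected h.order_le h.radius_pos h.const_pos hx.1 hx.2 hy.1 hy.2
        hxy).1.le
    · exact sub_nonneg.2 (h.mono y hy.1 _ _ (h.pos y hy.1).le (hl y hy))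
  have hm := (isOpen_annulus (n := n) r l).measurableSet
  have hne : ∀ᵐ y : EuclideanSpace ℝ (Fin n), y ∉ ({x} : Set _) :=
    measure_eq_zero_iff_ae_notMem.1 (measure_singleton _)
  have hnn : 0 ≤ᵐ[volume.restrict (annulus n r l)]
      foldedIntegrand n α r c l (fun y => f y (u y)) x := by
    rw [EventuallyLE, ae_restrict_iff' hm]
    filter_upwards [hne] with y h1 h2
    exact (hpos y h2 fun h => h1 h.symm).le
  have : 0 < ∫ y in annulus n r l, foldedIntegrand n α r c l (fun y => f y (u y)) x y := by
    rw [setIntegral_pos_iff_support_of_nonneg_ae hnn hi]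
    have hs : annulus n r l \ {x} ⊆
        Function.support (foldedIntegrand n α r c l (fun y => f y (u y)) x) ∩ annulus n r l :=
      fun y hy => ⟨(hpos y hy.1 fun h => hy.2 h.symm).ne', hy.1⟩
    refine lt_of_lt_of_le ?_ (measure_mono hs)
    rw [measure_sdiff_null (measure_singleton x)]
    exact (isOpen_annulus r l).measure_pos volume ⟨x, hx⟩
  linarith

/-- The part of the annulus in which the desired inequality `u ≤ u_l` fails. -/
def badSet (n : ℕ) (α r l : ℝ) (u : EuclideanSpace ℝ (Fin n) → ℝ) :
    Set (EuclideanSpace ℝ (Fin n)) :=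
  {y | y ∈ annulus n r l ∧ kelvinTransform n α l u y < u y}

lemma measurableSet_badSet (h : IsPositiveSolution n α r c f u) (l : ℝ) :
    MeasurableSet (badSet n α r l u) := by
  have hc : ContinuousOn (fun y => kelvinTransform n α l u y - u y) (annulus n r l) :=
    (h.kelvin_continuousOn l).sub (h.contOn.mono (annulus_subset_exteriorDomain r l))
  have := hc.isOpen_inter_preimage (isOpen_annulus r l) (isOpen_Iio (a := (0 : ℝ)))
  convert this.measurableSet using 1
  ext y
  simp only [badSet, Set.mem_ofPred_eq, Set.mem_inter_iff, Set.mem_preimage, Set.mem_Iio, sub_neg]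

/-- A contraction estimate for the positive part of `u - u_l`: the contraction factor is governed by
an integral over the bad set. -/
lemma exists_contraction (h : IsPositiveSolution n α r c f u) (b : ℝ) :
    ∃ γ C : ℝ, γ < 1 ∧ 0 ≤ C ∧ ∀ l ≤ b,
      C * (∫ y in badSet n α r l u, (‖y‖ - r) ^ (-γ)) ≤ 1 / 4 →
      ∀ S : ℝ, 0 ≤ S → (∀ x ∈ annulus n r l, u x - kelvinTransform n α l u x ≤ S) →
      ∀ x ∈ annulus n r l, u x - kelvinTransform n α l u x ≤ S / 2 := by
  have : NeZero n := ⟨h.dim_pos.ne'⟩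
  obtain ⟨M, hM0, hM⟩ := h.exists_bound b
  obtain ⟨θ, hθ, hLip⟩ := h.lipschitz
  obtain ⟨θ', β, hθ'0, hθθ', hβ0, hβθ, hcase⟩ :=
    exists_singular_exponents h.dim_pos h.order_pos h.order_le hθ
  obtain ⟨K, hK0, hK⟩ := exists_forall_weighted_lipschitz (b := b) hLip hθθ' hM0
  obtain ⟨C₁, hC₁0, hC₁⟩ := exists_rieszProfile_sub_le (b := b) h.radius_pos hβ0 hcase
  have hc := h.const_pos
  set κ := c * C₁ * K with hκ
  have hκ0 : 0 ≤ κ := by positivity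
  have hε : 0 < 1 / (4 * (κ + 1)) := by positivity
  obtain ⟨C, hC0, hC⟩ := exists_forall_singular_integral_le (b := b) h.dim_pos h.radius_pos
    hθ'0 hβ0 hβθ hε
  refine ⟨β / n + θ', κ * C, hβθ, by positivity, fun l hlb hsmall S hS0 hS x hx => ?_⟩
  have hl0 : 0 < l := h.radius_pos.trans (hx.1.trans hx.2)
  have hab : annulus n r l ⊆ annulus n r b := fun y hy => ⟨hy.1, hy.2.trans_le hlb⟩
  have hQm := h.measurableSet_badSet l
  have hQs : badSet n α r l u ⊆ annulus n r l := fun y hy => hy.1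
  obtain ⟨hi, hle⟩ := h.integral_folded_le hx
  obtain ⟨i1, hi1⟩ := hC x (hab hx) _ (hQs.trans hab) hQm
  have hm := (isOpen_annulus (n := n) r l).measurableSet
  have i2 := (i1.const_mul (κ * S))
  have i3 : IntegrableOn ((badSet n α r l u).indicator fun y =>
      κ * S * ((‖y‖ - r) ^ (-θ') * ‖x - y‖ ^ (-β))) (annulus n r l) :=
    ((integrable_indicator_iff hQm).2 i2).integrableOn
  have hne : ∀ᵐ y : EuclideanSpace ℝ (Fin n), y ∉ ({x} : Set _) :=
    measure_eq_zero_iff_ae_notMem.1 (measure_singleton _)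
  have hpt : ∀ᵐ y : EuclideanSpace ℝ (Fin n), y ∈ annulus n r l →
      -foldedIntegrand n α r c l (fun y => f y (u y)) x y ≤
        (badSet n α r l u).indicator (fun y =>
          κ * S * ((‖y‖ - r) ^ (-θ') * ‖x - y‖ ^ (-β))) y := by
    filter_upwards [hne] with y h1 hy
    have hxy : x ≠ y := fun h => h1 h.symm
    have hρ : 0 < ‖y‖ - r := sub_pos.2 hy.1
    have hd : 0 < ‖x - y‖ := norm_pos_iff.2 (sub_ne_zero.2 hxy)
    have hgt := h.folded_gt hx hy hxy
    obtain ⟨hP0, -, hP1⟩ := kelvinKernel_reflected h.order_le h.radius_pos h.const_pos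
      hx.1 hx.2 hy.1 hy.2 hxy
    set P := (l / ‖y‖) ^ ((n : ℝ) - α) * kelvinKernel n α r c l x (sphereInv l y) with hP
    by_cases hyQ : y ∈ badSet n α r l u
    · rw [Set.indicator_of_mem hyQ]
      have hP2 : P ≤ c * (C₁ * ‖x - y‖ ^ (-β)) :=
        hP1.trans (mul_le_mul_of_nonneg_left (hC₁ l hl0 hlb _ hd) hc.le)
      have hL := hK y (hab hy) _ _ (h.kelvin_pos hy).le hyQ.2.le (hM y (hab hy))
      have hL' : f y (u y) - f y (kelvinTransform n α l u y) ≤ K * (‖y‖ - r) ^ (-θ') * S :=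
        hL.trans (mul_le_mul_of_nonneg_left (hS y hy) (by positivity))
      calc -foldedIntegrand n α r c l (fun y => f y (u y)) x y
          ≤ P * (f y (u y) - f y (kelvinTransform n α l u y)) := by linarith
        _ ≤ P * (K * (‖y‖ - r) ^ (-θ') * S) := mul_le_mul_of_nonneg_left hL' hP0.le
        _ ≤ (c * (C₁ * ‖x - y‖ ^ (-β))) * (K * (‖y‖ - r) ^ (-θ') * S) :=
            mul_le_mul_of_nonneg_right hP2 (by positivity)
        _ = _ := by rw [hκ]; ring
    · rw [Set.indicator_of_notMem hyQ]
      have huv : u y ≤ kelvinTransform n α l u y := not_lt.1 fun h' => hyQ ⟨hy, h'⟩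
      have := h.mono y hy.1 _ _ (h.pos y hy.1).le huv
      have := mul_nonneg hP0.le (sub_nonneg.2 this)
      linarith
  have hint := setIntegral_mono_on_ae hi.neg i3 hm hpt
  simp only [Pi.neg_apply] at hint
  rw [integral_neg, setIntegral_indicator hQm, Set.inter_eq_self_of_subset_right hQs,
    integral_const_mul] at hint
  have h1 := mul_le_mul_of_nonneg_left hi1 (by positivity : 0 ≤ κ * S)
  have h2 : κ * (1 / (4 * (κ + 1))) ≤ 1 / 4 := by
    rw [mul_one_div, div_le_iff₀ (by positivity)]; linarith
  have h3 := mul_le_mul_of_nonneg_left h2 hS0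
  have h4 := mul_le_mul_of_nonneg_left hsmall hS0
  nlinarith

/-- The sphere can be moved a little further out: once `u < u_l₀`, the bad sets for radii slightly
larger than `l₀` are negligible. For `l₀ = r` the annulus is empty and the hypothesis void, which
starts the method. -/
lemma eventually_le_kelvin (h : IsPositiveSolution n α r c f u) {l₀ : ℝ}
    (hlt : ∀ x ∈ annulus n r l₀, u x < kelvinTransform n α l₀ u x) :
    ∀ᶠ l in 𝓝[>] l₀, ∀ x ∈ annulus n r l, u x ≤ kelvinTransform n α l u x := by
  have : NeZero n := ⟨h.dim_pos.ne'⟩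
  obtain ⟨γ, C, hγ, hC0, hC⟩ := h.exists_contraction (l₀ + 1)
  obtain ⟨M, hM0, hM⟩ := h.exists_bound (l₀ + 1)
  have hm := (isOpen_annulus (n := n) r (l₀ + 1)).measurableSet
  have ev1 : ∀ᶠ l in 𝓝[>] l₀, l ≤ l₀ + 1 :=
    mem_of_superset (Ioc_mem_nhdsGT (by linarith : l₀ < l₀ + 1)) fun l hl => hl.2
  have hsub : ∀ {l}, l ≤ l₀ + 1 → badSet n α r l u ⊆ annulus n r (l₀ + 1) :=
    fun hl y hy => ⟨hy.1.1, hy.1.2.trans_le hl⟩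
  have hlim : Tendsto (fun l => ∫ y in annulus n r (l₀ + 1),
      (badSet n α r l u).indicator (fun y => (‖y‖ - r) ^ (-γ)) y) (𝓝[>] l₀)
      (𝓝 (∫ y in annulus n r (l₀ + 1), (0 : ℝ))) := by
    refine tendsto_integral_filter_of_dominated_convergence (fun y => (‖y‖ - r) ^ (-γ)) ?_ ?_
      (integrableOn_dist_inner_sphere_rpow h.dim_pos h.radius_pos hγ) ?_
    · refine Eventually.of_forall fun l => ?_
      exact ((by fun_prop : Measurable fun y : EuclideanSpace ℝ (Fin n) =>
        (‖y‖ - r) ^ (-γ)).indicator (h.measurableSet_badSet l)).aestronglyMeasurable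
    · refine Eventually.of_forall fun l => ?_
      filter_upwards [ae_restrict_mem hm] with y hy
      have : 0 < ‖y‖ - r := sub_pos.2 hy.1
      refine (norm_indicator_le_norm_self _ _).trans ?_
      rw [Real.norm_of_nonneg (by positivity)]
    · have n1 : ∀ᵐ y : EuclideanSpace ℝ (Fin n),
          y ∉ Metric.sphere (0 : EuclideanSpace ℝ (Fin n)) l₀ :=
        measure_eq_zero_iff_ae_notMem.1 (Measure.addHaar_sphere _ _ _)
      filter_upwards [ae_restrict_mem hm, ae_restrict_of_ae n1] with y hy hy1
      have hy1' : ‖y‖ ≠ l₀ := by simpa using hy1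
      -- Off the sphere of radius `l₀`, each point leaves the bad sets as `l` decreases to `l₀`.
      have hev : ∀ᶠ l in 𝓝[>] l₀, y ∉ badSet n α r l u := by
        rcases hy1'.lt_or_gt with hlt' | hgt
        · have hc := (h.kelvin_continuousAt ⟨hy.1, hlt'⟩).eventually
            (lt_mem_nhds (hlt y ⟨hy.1, hlt'⟩))
          filter_upwards [nhdsWithin_le_nhds hc] with l hl hbad
          exact lt_asymm hl hbad.2
        · filter_upwards [nhdsWithin_le_nhds (gt_mem_nhds hgt)] with l hl hbad
          exact lt_asymm hl hbad.1.2
      refine tendsto_const_nhds.congr' ?_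
      filter_upwards [hev] with l hl
      rw [Set.indicator_of_notMem hl]
  rw [integral_zero] at hlim
  have hlim' := hlim.const_mul C
  rw [mul_zero] at hlim'
  filter_upwards [hlim'.eventually (gt_mem_nhds (by norm_num : (0 : ℝ) < 1 / 4)), ev1]
    with l hl1 hl2
  rw [setIntegral_indicator (h.measurableSet_badSet l),
    Set.inter_eq_self_of_subset_right (hsub hl2)] at hl1
  have key : ∀ k : ℕ, ∀ x ∈ annulus n r l, u x - kelvinTransform n α l u x ≤ M / 2 ^ k := by
    intro k
    induction k with
    | zero =>
      intro x hx
      have := h.kelvin_pos hx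
      have := hM x ⟨hx.1, hx.2.trans_le hl2⟩
      rw [pow_zero, div_one]; linarith
    | succ k ih =>
      have := hC l hl2 hl1.le _ (by positivity) ih
      rwa [div_div, ← pow_succ] at this
  intro x hx
  have ht : Tendsto (fun k : ℕ => M / 2 ^ k) atTop (𝓝 0) := by
    have := (tendsto_pow_atTop_nhds_zero_of_lt_one (r := (1 / 2 : ℝ)) (by norm_num)
      (by norm_num)).const_mul M
    rw [mul_zero] at this
    refine this.congr fun k => ?_
    rw [one_div, inv_pow, div_eq_mul_inv]
  have := ge_of_tendsto' ht fun k => key k x hx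
  linarith

/-- The outcome of the method of scaling spheres: `u` lies below its Kelvin transform inside every
sphere. The radii for which this holds form a closed set that contains `r` and extends to the
right of each of its points. -/
theorem le_kelvin (h : IsPositiveSolution n α r c f u) {l : ℝ} (hl : r ≤ l) :
    ∀ x ∈ annulus n r l, u x ≤ kelvinTransform n α l u x := by
  set s : Set ℝ := {l | ∀ x ∈ annulus n r l, u x ≤ kelvinTransform n α l u x} with hs
  have hclosed : IsClosed (s ∩ Set.Icc r l) := by
    refine isClosed_of_closure_subset fun l₀ hl₀ => ⟨fun x hx => ?_, ?_⟩
    · by_contra! hlt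
      have e1 := (h.kelvin_continuousAt hx).eventually (gt_mem_nhds hlt)
      have e2 : ∀ᶠ l' in 𝓝 l₀, ‖x‖ < l' := lt_mem_nhds hx.2
      obtain ⟨l', hl', h1, h2⟩ := ((mem_closure_iff_frequently.1 hl₀).and_eventually
        (e1.and e2)).exists
      exact absurd (hl'.1 x ⟨hx.1, h2⟩) (not_le.2 h1)
    · exact closure_minimal Set.inter_subset_right isClosed_Icc hl₀
  have hr : r ∈ s := fun x hx => absurd (hx.1.trans hx.2) (lt_irrefl _)
  refine hclosed.Icc_subset_of_forall_exists_gt hr (fun l₀ hl₀ y hy => ?_) ⟨hl, le_rfl⟩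
  have e1 := h.eventually_le_kelvin (h.lt_kelvin_of_le hl₀.1)
  obtain ⟨l', h1, h2⟩ := (e1.and (Ioc_mem_nhdsGT hy)).exists
  exact ⟨l', h1, h2⟩

/-- Comparison along rays, in spheres through the geometric mean of two radii, yields a first lower
bound for the decay of `u`. -/
theorem exists_lower_bound (h : IsPositiveSolution n α r c f u) :
    ∃ κ : ℝ, 0 < κ ∧ ∀ y : EuclideanSpace ℝ (Fin n), 2 * r ≤ ‖y‖ →
      κ * ‖y‖ ^ (-(((n : ℝ) - α) / 2)) ≤ u y := by
  have : NeZero n := ⟨h.dim_pos.ne'⟩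
  have hr := h.radius_pos
  -- The comparison sphere; any radius strictly between `r` and `2 * r` would do.
  set ρ := 3 / 2 * r with hρ
  have hρ0 : 0 < ρ := by positivity
  have hrρ : r < ρ := by linarith
  have hsph : Metric.sphere (0 : EuclideanSpace ℝ (Fin n)) ρ ⊆ exteriorDomain n r := by
    intro x hx
    rw [mem_sphere_zero_iff_norm] at hx
    show r < ‖x‖
    rw [hx]; exact hrρ
  obtain ⟨x₀, hx₀, hmin⟩ := (isCompact_sphere (0 : EuclideanSpace ℝ (Fin n)) ρ).exists_isMinOn
    (NormedSpace.sphere_nonempty.2 hρ0.le) (h.contOn.mono hsph)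
  have hm0 := h.pos x₀ (hsph hx₀)
  refine ⟨u x₀ * ρ ^ (((n : ℝ) - α) / 2), by positivity, fun y hy => ?_⟩
  have hy0 : 0 < ‖y‖ := by linarith
  have hq : 1 < ‖y‖ / ρ := by rw [one_lt_div hρ0]; linarith
  have hq0 : 0 < ‖y‖ / ρ := by positivity
  set l := ρ * (‖y‖ / ρ) ^ (1 / 2 : ℝ) with hl
  have hlρ : l / ρ = (‖y‖ / ρ) ^ (1 / 2 : ℝ) := by rw [hl]; field_simp
  have hl1 : ρ < l := by
    rw [← one_lt_div hρ0, hlρ]; exact Real.one_lt_rpow hq (by norm_num)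
  set x := (ρ / ‖y‖) • y with hx
  have hxn : ‖x‖ = ρ := by
    rw [hx, norm_smul, Real.norm_of_nonneg (by positivity)]; field_simp
  have hinv : sphereInv l x = y := by
    rw [sphereInv, hxn, hlρ, ← Real.rpow_natCast, ← Real.rpow_mul hq0.le, hx, smul_smul]
    norm_num
    rw [div_mul_div_cancel₀ hρ0.ne', div_self hy0.ne', one_smul]
  have hle := h.le_kelvin (hrρ.trans hl1).le x ⟨by rw [hxn]; exact hrρ, by rw [hxn]; exact hl1⟩
  rw [kelvinTransform, hinv, hxn, hlρ, ← Real.rpow_mul hq0.le] at hle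
  have hmin' : u x₀ ≤ u x := hmin (by rw [mem_sphere_zero_iff_norm]; exact hxn)
  have e : (1 / 2 : ℝ) * ((n : ℝ) - α) = ((n : ℝ) - α) / 2 := by ring
  rw [e, Real.div_rpow hy0.le hρ0.le] at hle
  have hp1 : 0 < ‖y‖ ^ (((n : ℝ) - α) / 2) := by positivity
  have hp2 : 0 < ρ ^ (((n : ℝ) - α) / 2) := by positivity
  have := hmin'.trans hle
  rw [Real.rpow_neg hy0.le, ← div_eq_mul_inv, div_le_iff₀ hp1]
  rwa [div_mul_eq_mul_div, le_div_iff₀ hp2, mul_comm (‖y‖ ^ _)] at this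

end IsPositiveSolution

end ScalingSpheres

/-! ### Bootstrapping the lower bound -/

section Bootstrap

variable {n : ℕ}

/-- Away from the boundary the reflected distance exceeds the distance by a fixed factor (`5 / 4`), so
the Green kernel is comparable with the Riesz kernel, or with a constant in the critical case. -/
lemma exists_exteriorGreen_ge {α r c : ℝ} (hα : α ≤ n) (hr : 0 < r) (hc : 0 < c) :
    ∃ κ : ℝ, 0 < κ ∧ ∀ x y : EuclideanSpace ℝ (Fin n), 2 * r ≤ ‖x‖ → ‖x‖ ≤ ‖y‖ → x ≠ y →
      κ * ‖y‖ ^ (-((n : ℝ) - α)) ≤ exteriorGreen n α r c x y := by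
  have ha : 0 ≤ (n : ℝ) - α := by linarith
  have hlt := rieszProfile_lt ha one_pos (by norm_num : (1 : ℝ) < 25 / 16)
  refine ⟨c * (rieszProfile (n - α) 1 - rieszProfile (n - α) (25 / 16)) * 2 ^ (-((n : ℝ) - α)),
    mul_pos (mul_pos hc (sub_pos.2 hlt)) (by positivity), fun x y hx hxy hne => ?_⟩
  have hd : 0 < ‖x - y‖ := norm_pos_iff.2 (sub_ne_zero.2 hne)
  have hy0 : 0 < ‖y‖ := by linarith
  have hd2 : ‖x - y‖ ≤ 2 * ‖y‖ := by
    have := norm_sub_le x y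
    linarith
  have hD : ‖x‖ ^ 2 + ‖y‖ ^ 2 - 2 * inner ℝ x y = ‖x - y‖ ^ 2 := by
    rw [norm_sub_sq_real]; ring
  rw [exteriorGreen_eq hr (by linarith) (by linarith) hne, reflected_sub_sq hr, hD]
  have h1 : ‖x - y‖ ^ 2 * (25 / 16) ≤
      ‖x - y‖ ^ 2 + (‖x‖ ^ 2 - r ^ 2) * (‖y‖ ^ 2 - r ^ 2) / r ^ 2 := by
    have hx2 : (2 * r) ^ 2 ≤ ‖x‖ ^ 2 := pow_le_pow_left₀ (by positivity) hx 2
    have hy2 : (2 * r) ^ 2 ≤ ‖y‖ ^ 2 := pow_le_pow_left₀ (by positivity) (hx.trans hxy) 2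
    have hd3 : ‖x - y‖ ^ 2 ≤ (2 * ‖y‖) ^ 2 := pow_le_pow_left₀ hd.le hd2 2
    have h3 : 3 * r ^ 2 * (3 / 4 * ‖y‖ ^ 2) ≤ (‖x‖ ^ 2 - r ^ 2) * (‖y‖ ^ 2 - r ^ 2) :=
      mul_le_mul (by linarith) (by linarith) (by positivity) (by nlinarith)
    have h4 : 9 / 4 * ‖y‖ ^ 2 ≤ (‖x‖ ^ 2 - r ^ 2) * (‖y‖ ^ 2 - r ^ 2) / r ^ 2 := by
      rw [le_div_iff₀ (by positivity)]; linarith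
    linarith
  have h2 := rieszProfile_le ha (by positivity) h1
  have h3 := rieszProfile_mul_sub (n - α) hd one_pos (by norm_num : (0 : ℝ) < 25 / 16)
  rw [mul_one] at h3
  have h4 : (2 : ℝ) ^ (-((n : ℝ) - α)) * ‖y‖ ^ (-((n : ℝ) - α)) ≤
      (1 / ‖x - y‖) ^ ((n : ℝ) - α) := by
    rw [← Real.mul_rpow (by norm_num) hy0.le, Real.rpow_neg (by positivity),
      ← Real.inv_rpow (by positivity), ← one_div]
    exact Real.rpow_le_rpow (by positivity) (one_div_le_one_div_of_le hd hd2) ha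
  have h5 := mul_le_mul_of_nonneg_right h4 (sub_pos.2 hlt).le
  rw [mul_assoc, mul_assoc]
  refine mul_le_mul_of_nonneg_left ?_ hc.le
  linarith

/-- A solid cone contains a family of dilated balls that stay away from its vertex. -/
lemma IsSolidCone.exists_ball (hn : 0 < n) {C : Set (EuclideanSpace ℝ (Fin n))}
    (hC : IsSolidCone n C) :
    ∃ (e : EuclideanSpace ℝ (Fin n)) (δ : ℝ), 0 < δ ∧ ∀ t : ℝ, 0 < t →
      ∀ y ∈ Metric.ball (t • e) (t * δ), y ∈ C ∧ 2 * t ≤ ‖y‖ ∧ ‖y‖ ≤ 6 * t := by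
  have : NeZero n := ⟨hn.ne'⟩
  obtain ⟨e₀, he₀, he₀'⟩ := (dense_compl_singleton
    (0 : EuclideanSpace ℝ (Fin n))).inter_open_nonempty _ isOpen_interior hC.2
  have hne : 0 < ‖e₀‖ := norm_pos_iff.2 he₀'
  obtain ⟨δ₀, hδ₀, hball⟩ := Metric.isOpen_iff.1 isOpen_interior e₀ he₀
  set k := 4 / ‖e₀‖ with hk
  have hk0 : 0 < k := by positivity
  refine ⟨k • e₀, k * min δ₀ (‖e₀‖ / 2), by positivity, fun t ht y hy => ?_⟩
  rw [mem_ball_iff_norm, smul_smul] at hy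
  have hnorm : ‖(t * k) • e₀‖ = 4 * t := by
    rw [norm_smul, Real.norm_of_nonneg (by positivity), hk]; field_simp
  have h1 : ‖y - (t * k) • e₀‖ < 2 * t := by
    refine hy.trans_le ?_
    calc t * (k * min δ₀ (‖e₀‖ / 2)) ≤ t * (k * (‖e₀‖ / 2)) := by
          gcongr; exact min_le_right _ _
      _ = 2 * t := by rw [hk]; field_simp; norm_num
  refine ⟨?_, ?_, ?_⟩
  · have h2 : (t * k)⁻¹ • y ∈ C := by
      refine interior_subset (hball ?_)
      rw [mem_ball_iff_norm]
      have e : (t * k)⁻¹ • y - e₀ = (t * k)⁻¹ • (y - (t * k) • e₀) := by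
        rw [smul_sub, inv_smul_smul₀ (by positivity)]
      rw [e, norm_smul, Real.norm_of_nonneg (by positivity), inv_mul_lt_iff₀ (by positivity)]
      refine hy.trans_le ?_
      rw [← mul_assoc]
      gcongr
      exact min_le_left _ _
    have := hC.1 _ h2 (t * k) (by positivity)
    rwa [smul_inv_smul₀ (by positivity)] at this
  · have := norm_sub_norm_le ((t * k) • e₀) y
    rw [norm_sub_rev, hnorm] at this
    linarith
  · have := norm_sub_norm_le y ((t * k) • e₀)
    rw [hnorm] at this
    linarith

/-- The minimum of the two constants covers both signs of the exponent. -/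
lemma min_rpow_mul_le {s t d : ℝ} (ht : 0 < t) (h2 : 2 * t ≤ d) (h6 : d ≤ 6 * t) :
    min (2 ^ s) (6 ^ s) * t ^ s ≤ d ^ s := by
  have hd : 0 < d := by linarith
  rcases le_total 0 s with hs | hs
  · calc min (2 ^ s) (6 ^ s) * t ^ s ≤ 2 ^ s * t ^ s := by gcongr; exact min_le_left _ _
      _ = (2 * t) ^ s := (Real.mul_rpow (by norm_num) ht.le).symm
      _ ≤ _ := Real.rpow_le_rpow (by positivity) h2 hs
  · calc min (2 ^ s) (6 ^ s) * t ^ s ≤ 6 ^ s * t ^ s := by gcongr; exact min_le_right _ _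
      _ = (6 * t) ^ s := (Real.mul_rpow (by norm_num) ht.le).symm
      _ ≤ _ := Real.rpow_le_rpow_of_nonpos hd h6 hs

namespace IsPositiveSolution

variable {α r c : ℝ} {f : EuclideanSpace ℝ (Fin n) → ℝ → ℝ} {u : EuclideanSpace ℝ (Fin n) → ℝ}

lemma integrand_nonneg (h : IsPositiveSolution n α r c f u) {x : EuclideanSpace ℝ (Fin n)}
    (hx : x ∈ exteriorDomain n r) :
    0 ≤ᵐ[volume.restrict (exteriorDomain n r)]
      fun y => exteriorGreen n α r c x y * f y (u y) := by
  have : NeZero n := ⟨h.dim_pos.ne'⟩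
  have hne : ∀ᵐ y : EuclideanSpace ℝ (Fin n), y ∉ ({x} : Set _) :=
    measure_eq_zero_iff_ae_notMem.1 (measure_singleton _)
  rw [EventuallyLE, ae_restrict_iff' (isOpen_exteriorDomain r).measurableSet]
  filter_upwards [hne] with y h1 h2
  exact mul_nonneg (exteriorGreen_pos h.order_le h.radius_pos h.const_pos hx h2
    fun h => h1 h.symm).le (h.nonneg y h2 _ (h.pos y h2).le)

/-- A power lower bound for `u` feeds back into a lower bound for the integral over the dilated
balls in the cone. -/
lemma exists_setIntegral_ge (h : IsPositiveSolution n α r c f u)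
    {C : Set (EuclideanSpace ℝ (Fin n))} {C' σ τ p : ℝ} (hC' : 0 < C') (hσ : 1 < σ) (hp : 0 < p)
    (hf : ∀ x ∈ C ∩ exteriorDomain n (2 * σ * r), ∀ v : ℝ, 0 ≤ v → C' * ‖x‖ ^ τ * v ^ p ≤ f x v)
    {e : EuclideanSpace ℝ (Fin n)} {δ : ℝ} (hδ : 0 < δ)
    (hball : ∀ t : ℝ, 0 < t → ∀ y ∈ Metric.ball (t • e) (t * δ),
      y ∈ C ∧ 2 * t ≤ ‖y‖ ∧ ‖y‖ ≤ 6 * t)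
    {κ μ : ℝ} (hκ : 0 < κ) (hu : ∀ x, 2 * σ * r ≤ ‖x‖ → κ * ‖x‖ ^ μ ≤ u x) :
    ∃ κ' : ℝ, 0 < κ' ∧ ∀ x : EuclideanSpace ℝ (Fin n), 2 * σ * r ≤ ‖x‖ → ∀ t : ℝ, ‖x‖ ≤ t →
      κ' * t ^ (α + τ + p * μ) ≤
        ∫ y in Metric.ball (t • e) (t * δ), exteriorGreen n α r c x y * f y (u y) := by
  have : NeZero n := ⟨h.dim_pos.ne'⟩
  have hr := h.radius_pos
  have hσr : 2 * r < 2 * σ * r := by nlinarith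
  obtain ⟨κ₀, hκ₀, hG⟩ := exists_exteriorGreen_ge (n := n) h.order_le hr h.const_pos
  set s := -((n : ℝ) - α) + τ + p * μ with hs
  set m : ℝ := min (2 ^ s) (6 ^ s) with hm
  have hm0 : 0 < m := by positivity
  set V := volume.real (Metric.ball (0 : EuclideanSpace ℝ (Fin n)) δ) with hV
  have hV0 : 0 < V := ENNReal.toReal_pos (Metric.measure_ball_pos volume _ hδ).ne'
    measure_ball_lt_top.ne
  refine ⟨κ₀ * C' * κ ^ p * m * V, by positivity, fun x hx t ht => ?_⟩
  have hx0 : 0 < ‖x‖ := by linarith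
  have ht0 : 0 < t := hx0.trans_le ht
  have hxΩ : x ∈ exteriorDomain n r := by show r < ‖x‖; linarith
  have hsub : Metric.ball (t • e) (t * δ) ⊆ exteriorDomain n r := fun y hy => by
    have := (hball t ht0 y hy).2.1
    show r < ‖y‖; linarith
  have hi := (h.sol x hxΩ).1.mono_set hsub
  have hpt : ∀ y ∈ Metric.ball (t • e) (t * δ), κ₀ * C' * κ ^ p * m * t ^ s ≤
      exteriorGreen n α r c x y * f y (u y) := by
    intro y hy
    obtain ⟨hyC, hy2, hy6⟩ := hball t ht0 y hy
    have hy0 : 0 < ‖y‖ := by linarith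
    have hyR : 2 * σ * r < ‖y‖ := by linarith
    have hxy : x ≠ y := by rintro rfl; linarith
    have g1 := hG x y (by linarith) (by linarith) hxy
    have hyΩ := hsub hy
    have g2 := hf y ⟨hyC, hyR⟩ (u y) (h.pos y hyΩ).le
    have g3 : (κ * ‖y‖ ^ μ) ^ p ≤ u y ^ p :=
      Real.rpow_le_rpow (by positivity) (hu y hyR.le) hp.le
    have e1 : (κ * ‖y‖ ^ μ) ^ p = κ ^ p * ‖y‖ ^ (p * μ) := by
      rw [Real.mul_rpow hκ.le (by positivity), ← Real.rpow_mul hy0.le, mul_comm μ p]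
    have g4 : C' * ‖y‖ ^ τ * (κ ^ p * ‖y‖ ^ (p * μ)) ≤ f y (u y) := by
      refine le_trans ?_ g2
      rw [← e1]; gcongr
    calc κ₀ * C' * κ ^ p * m * t ^ s = κ₀ * C' * κ ^ p * (m * t ^ s) := by ring
      _ ≤ κ₀ * C' * κ ^ p * ‖y‖ ^ s := by
          gcongr; exact min_rpow_mul_le ht0 hy2 hy6
      _ = (κ₀ * ‖y‖ ^ (-((n : ℝ) - α))) * (C' * ‖y‖ ^ τ * (κ ^ p * ‖y‖ ^ (p * μ))) := by
          rw [hs, Real.rpow_add hy0, Real.rpow_add hy0]; ring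
      _ ≤ _ := mul_le_mul g1 g4 (by positivity) (le_trans (by positivity) g1)
  have hvol : volume.real (Metric.ball (t • e) (t * δ)) = t ^ n * V := by
    rw [Measure.real, Measure.addHaar_ball_mul_of_pos _ _ ht0, finrank_euclideanSpace_fin,
      ENNReal.toReal_mul, ENNReal.toReal_ofReal (by positivity), hV, Measure.real]
  have hc := setIntegral_mono_on (integrableOn_const measure_ball_lt_top.ne) hi measurableSet_ball
    hpt
  rw [setIntegral_const, hvol, smul_eq_mul] at hc
  refine le_trans (le_of_eq ?_) hc
  have e2 : t ^ (α + τ + p * μ) = t ^ n * t ^ s := by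
    rw [← Real.rpow_natCast t n, ← Real.rpow_add ht0, hs]; congr 1; ring
  rw [e2]; ring

/-- The lower bounds from the cone condition improve at every step until they contradict the
convergence of the integral. -/
theorem not_assumptionF3 (h : IsPositiveSolution n α r c f u) : ¬ AssumptionF3 n α r f := by
  rintro ⟨C, C', σ, τ, p, hC, hC', hσ, hlt, heq, hf⟩
  have : NeZero n := ⟨h.dim_pos.ne'⟩
  have hr := h.radius_pos
  have hσr : 2 * r < 2 * σ * r := by nlinarith
  have hR0 : 0 < 2 * σ * r := by positivity
  obtain ⟨e, δ, hδ, hball⟩ := hC.exists_ball h.dim_pos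
  have hp : 0 < p := by
    rcases h.order_le.lt_or_eq with h' | h'
    exacts [(hlt h').2.1, (heq h').2]
  have hτ : 0 ≤ α + τ := by
    rcases h.order_le.lt_or_eq with h' | h'
    · linarith [(hlt h').1]
    · linarith [(heq h').1]
  set L : ℝ → Prop := fun μ => ∃ κ : ℝ, 0 < κ ∧
    ∀ x : EuclideanSpace ℝ (Fin n), 2 * σ * r ≤ ‖x‖ → κ * ‖x‖ ^ μ ≤ u x with hL
  have hmono : ∀ μ μ', μ' ≤ μ → L μ → L μ' := by
    rintro μ μ' hμ ⟨κ, hκ, hu⟩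
    refine ⟨κ * (2 * σ * r) ^ (μ - μ'), by positivity, fun x hx => le_trans ?_ (hu x hx)⟩
    have hx0 : 0 < ‖x‖ := hR0.trans_le hx
    have e1 : ‖x‖ ^ μ = ‖x‖ ^ (μ - μ') * ‖x‖ ^ μ' := by
      rw [← Real.rpow_add hx0]; congr 1; ring
    rw [e1, mul_assoc]
    have h0 : 0 ≤ μ - μ' := by linarith
    gcongr
  have hstep : ∀ μ, L μ → L (α + τ + p * μ) := by
    rintro μ ⟨κ, hκ, hu⟩
    obtain ⟨κ', hκ', hint⟩ := h.exists_setIntegral_ge hC' hσ hp hf hδ hball hκ hu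
    refine ⟨κ', hκ', fun x hx => (hint x hx ‖x‖ le_rfl).trans ?_⟩
    have hx0 : 0 < ‖x‖ := hR0.trans_le hx
    have hxΩ : x ∈ exteriorDomain n r := by show r < ‖x‖; linarith
    rw [(h.sol x hxΩ).2]
    refine setIntegral_mono_set (h.sol x hxΩ).1 (h.integrand_nonneg hxΩ)
      (LE.le.eventuallyLE fun y hy => ?_)
    have := (hball _ hx0 y hy).2.1
    show r < ‖y‖; linarith
  have hstart : L (-(((n : ℝ) - α) / 2)) := by
    obtain ⟨κ, hκ, hu⟩ := h.exists_lower_bound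
    exact ⟨κ, hκ, fun x hx => hu x (hσr.le.trans hx)⟩
  have hzero : L 0 := by
    rcases h.order_le.lt_or_eq with h' | h'
    · obtain ⟨hτ', -, hp'⟩ := hlt h'
      have ha : 0 < (n : ℝ) - α := by linarith
      rw [lt_div_iff₀ ha] at hp'
      set μ₀ := -(((n : ℝ) - α) / 2) with hμ₀
      have hμ₀n : μ₀ < 0 := by rw [hμ₀]; linarith
      -- The gain `α + τ + p μ - μ` is affine in `μ` and positive at both ends of `[μ₀, 0]`.
      set η := min (α + τ) (α + τ + p * μ₀ - μ₀) with hη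
      have hη0 : 0 < η := lt_min (by linarith) (by rw [hμ₀]; linarith)
      have hgain : ∀ μ, μ₀ ≤ μ → μ ≤ 0 → μ + η ≤ α + τ + p * μ := by
        intro μ h1 h2
        have m1 : η ≤ α + τ := min_le_left _ _
        have m2 : η ≤ α + τ + p * μ₀ - μ₀ := min_le_right _ _
        rcases le_total 1 p with hp1 | hp1
        · nlinarith
        · nlinarith
      have hk : ∀ k : ℕ, L (min (μ₀ + k * η) 0) := by
        intro k
        induction k with
        | zero =>
          have : min (μ₀ + (0 : ℕ) * η) 0 = μ₀ := by simp [hμ₀n.le]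
          rw [this]; exact hstart
        | succ k ih =>
          refine hmono _ _ (le_trans ?_ (hgain _ (le_min ?_ hμ₀n.le) (min_le_right _ _)))
            (hstep _ ih)
          · push_cast
            rcases le_total (μ₀ + k * η) 0 with h1 | h1
            · rw [min_eq_left h1]; exact (min_le_left _ _).trans (by linarith)
            · rw [min_eq_right h1]; exact (min_le_right _ _).trans (by linarith)
          · have : 0 ≤ (k : ℝ) * η := by positivity
            linarith
      obtain ⟨k, hk'⟩ := exists_nat_gt (-μ₀ / η)
      rw [div_lt_iff₀ hη0] at hk'
      have := hk k
      rwa [min_eq_right (by linarith)] at this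
    · rwa [h', sub_self, zero_div, neg_zero] at hstart
  obtain ⟨κ, hκ, hu⟩ := hzero
  obtain ⟨κ', hκ', hint⟩ := h.exists_setIntegral_ge hC' hσ hp hf hδ hball hκ hu
  obtain ⟨x, hx⟩ := (NormedSpace.sphere_nonempty (x := (0 : EuclideanSpace ℝ (Fin n)))).2 hR0.le
  rw [mem_sphere_zero_iff_norm] at hx
  have hxΩ : x ∈ exteriorDomain n r := by show r < ‖x‖; linarith
  have hi := (h.sol x hxΩ).1
  -- The dilated balls escape to infinity, so the integrals over them tend to zero.
  have hlim : Tendsto (fun t : ℝ => ∫ y in exteriorDomain n r,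
      (Metric.ball (t • e) (t * δ)).indicator
        (fun y => exteriorGreen n α r c x y * f y (u y)) y) atTop
      (𝓝 (∫ y in exteriorDomain n r, (0 : ℝ))) := by
    refine tendsto_integral_filter_of_dominated_convergence
      (fun y => ‖exteriorGreen n α r c x y * f y (u y)‖) ?_ ?_ hi.norm ?_
    · exact Eventually.of_forall fun t => hi.aestronglyMeasurable.indicator measurableSet_ball
    · exact Eventually.of_forall fun t => Eventually.of_forall fun y =>
        norm_indicator_le_norm_self _ _
    · refine Eventually.of_forall fun y => tendsto_const_nhds.congr' ?_
      filter_upwards [eventually_gt_atTop ‖y‖, eventually_gt_atTop 0] with t h1 h2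
      rw [Set.indicator_of_notMem]
      intro hy
      have := (hball t h2 y hy).2.1
      linarith
  rw [integral_zero] at hlim
  obtain ⟨t, ht1, ht2, ht3⟩ := ((hlim.eventually (gt_mem_nhds hκ')).and
    ((eventually_ge_atTop ‖x‖).and (eventually_ge_atTop 1))).exists
  have ht0 : 0 < t := by linarith
  have hsub : Metric.ball (t • e) (t * δ) ⊆ exteriorDomain n r := fun y hy => by
    have := (hball _ ht0 y hy).2.1
    show r < ‖y‖; linarith
  rw [setIntegral_indicator measurableSet_ball, Set.inter_eq_self_of_subset_right hsub] at ht1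
  have h1 := hint x hx.ge t ht2
  have h2 : 1 ≤ t ^ (α + τ + p * 0) := Real.one_le_rpow ht3 (by linarith)
  nlinarith

end IsPositiveSolution

end Bootstrap

/-! ### The Liouville theorem -/

theorem theorem1p5 (n m : ℕ) (hn : 2 ≤ n) (hm : 1 ≤ m) (hmn : 2 * m ≤ n)
    (r : ℝ) (hr : 0 < r) (c : ℝ) (hc : 0 < c)
    (f : EuclideanSpace ℝ (Fin n) → ℝ → ℝ)
    (hf : ∀ x ∈ exteriorDomain n r, ∀ u : ℝ, 0 ≤ u → 0 ≤ f x u)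
    (hsub : SubcriticalGrowth n (2 * m) r f)
    (hf1 : AssumptionF1 n r f)
    (hf2 : AssumptionF2 n (2 * m) r f)
    (hf3 : AssumptionF3 n (2 * m) r f)
    (u : EuclideanSpace ℝ (Fin n) → ℝ)
    (hucont : ContinuousOn u (closure (exteriorDomain n r)))
    (hunonneg : ∀ x ∈ closure (exteriorDomain n r), 0 ≤ u x)
    (husol : IsIntegralSolution n (2 * m) r c f u) :
    ∀ x ∈ closure (exteriorDomain n r), u x = 0 := by
  have hn0 : NeZero n := ⟨by omega⟩
  have hαn : 2 * (m : ℝ) ≤ n := by exact_mod_cast hmn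
  have hΩ := isOpen_exteriorDomain (n := n) r
  have hu0 : ∀ x ∈ exteriorDomain n r, 0 ≤ u x := fun x hx => hunonneg x (subset_closure hx)
  suffices hzero : ∀ x ∈ exteriorDomain n r, u x = 0 by
    intro x hx
    have hne : (𝓝[exteriorDomain n r] x).NeBot := mem_closure_iff_nhdsWithin_neBot.1 hx
    refine tendsto_nhds_unique ((hucont x hx).mono_left (nhdsWithin_mono _ subset_closure)) ?_
    refine tendsto_const_nhds.congr' ?_
    filter_upwards [self_mem_nhdsWithin] with y hy
    exact (hzero y hy).symm
  by_contra! hex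
  obtain ⟨x₀, hx₀, hux₀⟩ := hex
  -- If `u` vanished at one point then the integrand, hence `f y (u y)`, would vanish almost
  -- everywhere.
  have hpos : ∀ x ∈ exteriorDomain n r, 0 < u x := by
    intro x hx
    refine lt_of_le_of_ne (hu0 x hx) fun hux => hux₀ ?_
    have hne : ∀ᵐ y : EuclideanSpace ℝ (Fin n), y ∉ ({x} : Set _) :=
      measure_eq_zero_iff_ae_notMem.1 (measure_singleton _)
    have hG : ∀ᵐ y ∂(volume.restrict (exteriorDomain n r)),
        0 < exteriorGreen n (2 * m) r c x y ∧ 0 ≤ f y (u y) := by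
      rw [ae_restrict_iff' hΩ.measurableSet]
      filter_upwards [hne] with y h1 h2
      exact ⟨exteriorGreen_pos hαn hr hc hx h2 fun h => h1 h.symm, hf y h2 _ (hu0 y h2)⟩
    obtain ⟨hi, hux'⟩ := husol x hx
    rw [← hux, eq_comm] at hux'
    have h0 := (setIntegral_eq_zero_iff_of_nonneg_ae
      (by filter_upwards [hG] with y hy using mul_nonneg hy.1.le hy.2) hi).1 hux'
    rw [(husol x₀ hx₀).2, ← integral_zero (EuclideanSpace ℝ (Fin n)) ℝ]
    refine integral_congr_ae ?_
    filter_upwards [hG, h0] with y h1 h2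
    rw [(mul_eq_zero.1 h2).resolve_left h1.1.ne', mul_zero]
  have hm0 : (0 : ℝ) < 2 * m := by
    have : (0 : ℝ) < m := by exact_mod_cast hm
    positivity
  have h : IsPositiveSolution n (2 * m) r c f u :=
    { dim_pos := by omega, order_pos := hm0, order_le := hαn, radius_pos := hr, const_pos := hc
      nonneg := hf, growth := hsub, mono := hf1, lipschitz := hf2, cont := hucont
      pos := hpos, sol := husol }
  exact h.not_assumptionF3 hf3
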